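/- For $|\arg z|<\pi$ let $J_\nu(z)=\sum_{k\ge0}\frac{(-1)^k}{k!\,\Gamma(k+\nu+1)}(z/2)^{2k+\nu}$, $I_\nu(z)=\sum_{k\ge0}\frac{1}{k!\,\Gamma(k+\nu+1)}(z/2)^{2k+\nu}$ (principal powers), $Y_\nu(z)=\lim_{\mu\to\nu}\frac{J_\mu(z)\cos(\mu\pi)-J_{-\mu}(z)}{\sin(\mu\pi)}$, $K_\nu(z)=\frac{\pi}{2}\lim_{\mu\to\nu}\frac{I_{-\mu}(z)-I_\mu(z)}{\sin(\mu\pi)}$ be the Bessel and modified Bessel functions, and let $H_0^{(1)}=J_0+iY_0$, $H_0^{(2)}=J_0-iY_0$. Let $m$ be a positive integer. (1) For every integer $n\ge1$ the integral $$b_{m,n}:=\int_0^\infty \frac{[\pi I_0(t)+iK_0(t)]^m-[\pi I_0(t)-iK_0(t)]^m}{\pi i}\,[K_0(t)]^m\,t^{2n+m-3}\,dt$$ converges absolutely. (2) For every integer $N\ge1$, as $|z|\to\infty$ with $|\arg z|<\pi$, $$\Big(\frac{\pi}{2}\Big)^{2m}\big[H_0^{(1)}(z)H_0^{(2)}(z)\big]^m=\sum_{n=1}^N\frac{(-1)^{n+1}}{z^{2n+m-2}}\,b_{m,n}+O\Big(\frac1{|z|^{2N+m}}\Big),$$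 where, as is usual for asymptotic expansions in an open sector, the $O$-estimate is uniform in every sector $|\arg z|\le\pi-\delta$ with $\delta>0$ (the implied constant depends on $m$, $N$ and $\delta$). (3) Consequently, for every integer $n\ge1$ the number $$C_{m,n}:=\frac{2^{1+2(n-1)[1-(-1)^m]}}{\pi^{m+1}}\int_0^\infty\frac{[\pi I_0(t)+iK_0(t)]^m-[\pi I_0(t)-iK_0(t)]^m}{i}\,[K_0(t)]^m\,(2t)^{2n+m-3}\,dt$$ is rational. -/

import Mathlib

open Filter Topology

noncomputable section

/-- Bessel function of the first kind of order `ν` (power series, principal powers;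
`Complex.Gamma` is `0` at its poles, so that `1 / Γ` is the entire reciprocal Gamma function). -/
def besselJ (ν z : ℂ) : ℂ :=
  ∑' k : ℕ, (-1) ^ k / ((k.factorial : ℂ) * Complex.Gamma (k + ν + 1)) * (z / 2) ^ (2 * (k : ℂ) + ν)

/-- Bessel function of the second kind of order `ν`,
`lim_{μ → ν} (J_μ(z) cos(μπ) - J_{-μ}(z)) / sin(μπ)`. -/
def besselY (ν z : ℂ) : ℂ :=
  limUnder (𝓝[≠] ν) fun μ : ℂ =>
    (besselJ μ z * Complex.cos (μ * Real.pi) - besselJ (-μ) z) / Complex.sin (μ * Real.pi)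

/-- Modified Bessel function of the first kind of order `ν`. -/
def besselI (ν z : ℂ) : ℂ :=
  ∑' k : ℕ, 1 / ((k.factorial : ℂ) * Complex.Gamma (k + ν + 1)) * (z / 2) ^ (2 * (k : ℂ) + ν)

/-- Modified Bessel function of the second kind of order `ν`,
`(π / 2) lim_{μ → ν} (I_{-μ}(z) - I_μ(z)) / sin(μπ)`. -/
def besselK (ν z : ℂ) : ℂ :=
  (Real.pi : ℂ) / 2 * limUnder (𝓝[≠] ν) fun μ : ℂ =>
    (besselI (-μ) z - besselI μ z) / Complex.sin (μ * Real.pi)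

/-- The Hankel function `H_0^{(1)} = J_0 + i Y_0`. -/
def hankelOne (z : ℂ) : ℂ := besselJ 0 z + Complex.I * besselY 0 z

/-- The Hankel function `H_0^{(2)} = J_0 - i Y_0`. -/
def hankelTwo (z : ℂ) : ℂ := besselJ 0 z - Complex.I * besselY 0 z

/-- `[π I_0(t) + i K_0(t)]^m - [π I_0(t) - i K_0(t)]^m`. -/
def besselDiff (m : ℕ) (t : ℝ) : ℂ :=
  (Real.pi * besselI 0 t + Complex.I * besselK 0 t) ^ m
    - (Real.pi * besselI 0 t - Complex.I * besselK 0 t) ^ m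

/-- The integrand `{[π I_0 + i K_0]^m - [π I_0 - i K_0]^m} / (π i) · K_0^m · t^{2n+m-3}`
(for `m, n ≥ 1` the exponent is a true natural number). -/
def momentIntegrand (m n : ℕ) (t : ℝ) : ℂ :=
  besselDiff m t / (Real.pi * Complex.I) * besselK 0 t ^ m * (t : ℂ) ^ (2 * n + m - 3)

/-- The generalized Crandall number `C_{m,n}` for `m, n ≥ 1`. -/
def crandallC (m n : ℕ) : ℂ :=
  (2 : ℂ) ^ (1 + 2 * ((n : ℤ) - 1) * (1 - (-1) ^ m)) / (Real.pi : ℂ) ^ (m + 1)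
    * ∫ t in Set.Ioi (0 : ℝ),
        besselDiff m t / Complex.I * besselK 0 t ^ m * (2 * (t : ℂ)) ^ (2 * n + m - 3)

end

/-!
The whole argument takes place in the variable `u = log z`, in which the Bessel equation of order
`0` becomes `f'' = -e^{2u} f`, the modified one `f'' = e^{2u} f`, and all functions are entire.
Differentiating the defining series termwise in the order at `ν = 0` gives `I_0(e^u)` and
`K_0(e^u)` as the explicit functions `expI` and `expK`, and
`(π / 2)² H_0^{(1)} H_0^{(2)}` becomes `Q(u) = expK (u - iπ/2) * expK (u + iπ/2)` (`hankelProd`,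
`hankel_mul_eq`).

*Growth.* On the positive half-line `K_0 / I_0` is a mean of `H_k - γ - log (z / 2)` over a
probability distribution on `k`, which is `O(1/z)` because the mean of `k²` is `(z/2)²`
(`realK_le`, `neg_le_realK`). With the Wronskian this gives `K_0 ≥ 0` and the boundedness of
`K_0 I_0`. Together with the energy estimate for the oscillating solutions it bounds `Q` on the rays
`arg z = 0, ±π/2, ±π`, and the Phragmén–Lindelöf principle yields a bound polynomial in `log z`
in the whole cut plane (`norm_hankelProd_le_sq`).

*Expansion.* `Q` satisfies `Q''' = -4 e^{2u} (Q + Q')`, that is, `(e^u Q)' = -e^{-u} Q''' / 4`. Cauchy's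
estimate bounds `Q'''` by `Q` in a slightly narrower sector, so each integration of this identity
gains a factor `z^{-2}`. This produces the full expansion of `e^u Q` in powers of `z^{-2}` from the
crude bound (`hankelNormal_expansion`), with rational coefficients up to the factor `π / 2`. The
leading constant follows from the first integral of the third-order equation, the square of the
Wronskian of the Hankel functions.

*Moments.* The expansion identifies the integrals: Cauchy's theorem for `z^{2j+m-1} Q^m dz` on a large
half-disc in the right half-plane, which is a rectangle in the variable `u`, equates the integral
over the imaginary axis, a multiple of the moment, to `πi` times the coefficient of `z^{-(2j+m)}`, as
all other terms integrate to zero over the half-circle (`integral_momentJump`). Hence the moments are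
the coefficients of the expansion, and they are rational multiples of `π^m`.
-/

/-! ### Exponential series with rapidly decreasing coefficients -/

/-- Real coefficients bounded by `C (D ^ k / k!) ^ 2`, the decay of the coefficients of `I_0`. -/
def IsRapid (a : ℕ → ℝ) : Prop :=
  ∃ C D : ℝ, 0 ≤ C ∧ 0 ≤ D ∧ ∀ k, |a k| ≤ C * (D ^ k / k.factorial) ^ 2

/-- The series `∑ a_k e^{2ku}`, that is, a power series in `z ^ 2` in the variable `u = log z`. -/
noncomputable def expSeries (a : ℕ → ℝ) (u : ℂ) : ℂ :=
  ∑' k : ℕ, (a k : ℂ) * Complex.exp (2 * k * u)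

lemma norm_expSeries_term (a : ℕ → ℝ) (k : ℕ) (u : ℂ) :
    ‖(a k : ℂ) * Complex.exp (2 * k * u)‖ = |a k| * Real.exp u.re ^ (2 * k) := by
  rw [norm_mul, Complex.norm_real, Real.norm_eq_abs, Complex.norm_exp, ← Real.exp_nat_mul]
  congr 2
  simp

lemma rapid_term_le {a : ℕ → ℝ} {C D : ℝ} (hC : 0 ≤ C) (hD : 0 ≤ D)
    (h : ∀ k, |a k| ≤ C * (D ^ k / k.factorial) ^ 2) {r : ℝ} (hr : 0 ≤ r) (k : ℕ) :
    |a k| * r ^ (2 * k) ≤ C * Real.exp (D * r) * ((D * r) ^ k / k.factorial) := by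
  have h1 : (D * r) ^ k / k.factorial ≤ Real.exp (D * r) :=
    Real.pow_div_factorial_le_exp _ (by positivity) k
  have h2 : 0 ≤ (D * r) ^ k / k.factorial := by positivity
  calc |a k| * r ^ (2 * k) ≤ C * (D ^ k / k.factorial) ^ 2 * r ^ (2 * k) := by
        gcongr; exact h k
    _ = C * ((D * r) ^ k / k.factorial) * ((D * r) ^ k / k.factorial) := by
        rw [mul_pow, pow_mul']; ring
    _ ≤ C * Real.exp (D * r) * ((D * r) ^ k / k.factorial) := by gcongr

lemma IsRapid.summable_abs {a : ℕ → ℝ} (ha : IsRapid a) {r : ℝ} (hr : 0 ≤ r) :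
    Summable fun k => |a k| * r ^ (2 * k) := by
  obtain ⟨C, D, hC, hD, h⟩ := ha
  exact Summable.of_nonneg_of_le (fun k => by positivity) (rapid_term_le hC hD h hr)
    ((Real.summable_pow_div_factorial (D * r)).mul_left _)

lemma IsRapid.summable_norm {a : ℕ → ℝ} (ha : IsRapid a) (u : ℂ) :
    Summable fun k : ℕ => ‖(a k : ℂ) * Complex.exp (2 * k * u)‖ := by
  simp_rw [norm_expSeries_term]
  exact ha.summable_abs (Real.exp_pos _).le

lemma IsRapid.summable {a : ℕ → ℝ} (ha : IsRapid a) (u : ℂ) :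
    Summable fun k : ℕ => (a k : ℂ) * Complex.exp (2 * k * u) :=
  (ha.summable_norm u).of_norm

lemma IsRapid.norm_expSeries_le {a : ℕ → ℝ} (ha : IsRapid a) :
    ∃ C D : ℝ, 0 ≤ C ∧ 0 ≤ D ∧ ∀ u, ‖expSeries a u‖ ≤ C * Real.exp (D * Real.exp u.re) := by
  have ha' := ha
  obtain ⟨C, D, hC, hD, h⟩ := ha
  refine ⟨C, 2 * D, hC, by positivity, fun u => ?_⟩
  have hs := (Real.summable_pow_div_factorial (D * Real.exp u.re))
  calc ‖expSeries a u‖ ≤ ∑' k : ℕ, ‖(a k : ℂ) * Complex.exp (2 * k * u)‖ :=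
        norm_tsum_le_tsum_norm (ha'.summable_norm u)
    _ ≤ ∑' k : ℕ, C * Real.exp (D * Real.exp u.re) *
          ((D * Real.exp u.re) ^ k / k.factorial) := by
        refine (ha'.summable_norm u).tsum_le_tsum (fun k => ?_) (hs.mul_left _)
        rw [norm_expSeries_term]
        exact rapid_term_le hC hD h (Real.exp_pos _).le k
    _ = C * Real.exp (2 * D * Real.exp u.re) := by
        rw [tsum_mul_left, ← congrFun NormedSpace.exp_eq_tsum_div (D * Real.exp u.re),
          ← Real.exp_eq_exp_ℝ, mul_assoc, ← Real.exp_add]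
        ring_nf

lemma IsRapid.two_mul_natCast_mul {a : ℕ → ℝ} (ha : IsRapid a) :
    IsRapid fun k => 2 * k * a k := by
  obtain ⟨C, D, hC, hD, h⟩ := ha
  refine ⟨2 * C, 2 * D, by positivity, by positivity, fun k => ?_⟩
  have hk : (k : ℝ) ≤ (2 ^ k) ^ 2 := by
    have h1 : (k : ℝ) ≤ 2 ^ k := by exact_mod_cast Nat.lt_two_pow_self.le
    have h2 : (1 : ℝ) ≤ 2 ^ k := one_le_pow₀ (by norm_num)
    nlinarith
  rw [abs_mul, abs_of_nonneg (by positivity : (0 : ℝ) ≤ 2 * k)]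
  calc 2 * (k : ℝ) * |a k| ≤ 2 * (2 ^ k) ^ 2 * (C * (D ^ k / k.factorial) ^ 2) := by
        gcongr; exact h k
    _ = _ := by rw [mul_pow]; ring

lemma IsRapid.hasDerivAt {a : ℕ → ℝ} (ha : IsRapid a) (u : ℂ) :
    HasDerivAt (expSeries a) (expSeries (fun k => 2 * k * a k) u) u := by
  have hR := ha.two_mul_natCast_mul.summable_abs (Real.exp_pos (u.re + 1)).le
  refine hasDerivAt_tsum_of_isPreconnected (t := {z : ℂ | z.re < u.re + 1}) hR
    (isOpen_lt Complex.continuous_re continuous_const)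
    (convex_halfSpace_re_lt _).isPreconnected
    (g' := fun k z => ((2 * k * a k : ℝ) : ℂ) * Complex.exp (2 * k * z))
    (fun k z _ => ?_) (fun k z hz => ?_) (y₀ := u) (by simp) (ha.summable u) (by simp)
  · have := (((hasDerivAt_id z).const_mul (2 * k : ℂ)).cexp).const_mul (a k : ℂ)
    refine this.congr_deriv ?_
    simp only [id_eq]
    push_cast
    ring
  · refine (norm_expSeries_term (fun k => 2 * k * a k) k z).trans_le ?_
    have : Real.exp z.re ≤ Real.exp (u.re + 1) := Real.exp_le_exp.2 (le_of_lt hz)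
    gcongr

lemma expSeries_add {a b : ℕ → ℝ} (ha : IsRapid a) (hb : IsRapid b) (u : ℂ) :
    expSeries (fun k => a k + b k) u = expSeries a u + expSeries b u := by
  rw [expSeries, expSeries, expSeries, ← (ha.summable u).tsum_add (hb.summable u)]
  refine tsum_congr fun k => ?_
  push_cast; ring

lemma expSeries_const_mul (c : ℝ) (a : ℕ → ℝ) (u : ℂ) :
    expSeries (fun k => c * a k) u = c * expSeries a u := by
  rw [expSeries, expSeries, ← tsum_mul_left]
  refine tsum_congr fun k => ?_
  push_cast; ring

lemma expSeries_shift {a c : ℕ → ℝ} (hc : IsRapid c) (h0 : c 0 = 0) (h : ∀ k, c (k + 1) = a k)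
    (u : ℂ) : expSeries c u = Complex.exp (2 * u) * expSeries a u := by
  rw [expSeries, expSeries, (hc.summable u).tsum_eq_zero_add, ← tsum_mul_left]
  simp only [h0, Complex.ofReal_zero, zero_mul, zero_add]
  refine tsum_congr fun k => ?_
  rw [h, mul_left_comm, ← Complex.exp_add]
  push_cast; ring_nf

lemma expSeries_tendsto_atBot {a : ℕ → ℝ} (ha : IsRapid a) :
    Tendsto (fun s : ℝ => expSeries a s) atBot (𝓝 (a 0 : ℂ)) := by
  have key : Tendsto (fun s : ℝ => expSeries a s) atBot
      (𝓝 (∑' k : ℕ, if k = 0 then (a 0 : ℂ) else 0)) := by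
    refine tendsto_tsum_of_dominated_convergence (bound := fun k => |a k| * 1 ^ (2 * k))
      (ha.summable_abs zero_le_one) (fun k => ?_) ?_
    · rcases Nat.eq_zero_or_pos k with rfl | hk
      · simp
      · rw [if_neg hk.ne', tendsto_zero_iff_norm_tendsto_zero]
        simp_rw [norm_expSeries_term, Complex.ofReal_re]
        have := (Real.tendsto_exp_atBot.pow (2 * k)).const_mul |a k|
        rwa [zero_pow (by lia), mul_zero] at this
    · filter_upwards [eventually_le_atBot 0] with s hs k
      rw [norm_expSeries_term, Complex.ofReal_re]
      gcongr
      exact Real.exp_le_one_iff.2 hs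
  rwa [tsum_ite_eq] at key

lemma expSeries_conj (a : ℕ → ℝ) (u : ℂ) :
    expSeries a (starRingEnd ℂ u) = starRingEnd ℂ (expSeries a u) := by
  rw [expSeries, expSeries, Complex.conj_tsum]
  refine tsum_congr fun k => ?_
  rw [map_mul, Complex.conj_ofReal, ← Complex.exp_conj, map_mul, map_mul, Complex.conj_ofNat,
    Complex.conj_natCast]

lemma expSeries_add_pi_mul_I (a : ℕ → ℝ) (u : ℂ) :
    expSeries a (u + Real.pi * Complex.I) = expSeries a u := by
  refine tsum_congr fun k => ?_
  congr 1
  rw [show (2 : ℂ) * k * (u + Real.pi * Complex.I) =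
    2 * k * u + k * (2 * Real.pi * Complex.I) by ring]
  exact Complex.exp_periodic.nat_mul k _

lemma expSeries_ofReal (a : ℕ → ℝ) (s : ℝ) :
    expSeries a s = ((∑' k, a k * Real.exp s ^ (2 * k) : ℝ) : ℂ) := by
  rw [expSeries, Complex.ofReal_tsum]
  refine tsum_congr fun k => ?_
  rw [← Real.exp_nat_mul]
  push_cast; ring_nf

/-! ### The entire functions `I_0(e^u)` and `K_0(e^u)` -/

/-- The coefficients `1 / (4 ^ k k!²)` of `I_0`. -/
noncomputable def coeffI (k : ℕ) : ℝ := 1 / (4 ^ k * (k.factorial : ℝ) ^ 2)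

/-- The coefficients `H_k / (4 ^ k k!²)` of the holomorphic part of `K_0`. -/
noncomputable def coeffB (k : ℕ) : ℝ := (harmonic k : ℝ) * coeffI k

lemma coeffI_pos (k : ℕ) : 0 < coeffI k := by unfold coeffI; positivity

lemma coeffI_succ (k : ℕ) : 4 * ((k : ℝ) + 1) ^ 2 * coeffI (k + 1) = coeffI k := by
  unfold coeffI
  rw [Nat.factorial_succ]
  push_cast
  field_simp
  ring

lemma isRapid_coeffI : IsRapid coeffI := by
  refine ⟨1, 1 / 2, by norm_num, by norm_num, fun k => ?_⟩
  rw [abs_of_pos (coeffI_pos k), coeffI]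
  apply le_of_eq
  rw [one_div_pow, div_pow, div_pow, ← pow_mul, mul_comm k 2, pow_mul]
  norm_num
  ring

lemma harmonic_nonneg_le (k : ℕ) : 0 ≤ (harmonic k : ℝ) ∧ (harmonic k : ℝ) ≤ k := by
  induction k with
  | zero => simp
  | succ k ih =>
    rw [harmonic_succ]
    push_cast
    have : ((k : ℝ) + 1)⁻¹ ≤ 1 := inv_le_one_of_one_le₀ (by linarith [k.cast_nonneg (α := ℝ)])
    have : 0 ≤ ((k : ℝ) + 1)⁻¹ := by positivity
    constructor <;> linarith

lemma isRapid_coeffB : IsRapid coeffB := by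
  obtain ⟨C, D, hC, hD, h⟩ := isRapid_coeffI.two_mul_natCast_mul
  refine ⟨C, D, hC, hD, fun k => le_trans ?_ (h k)⟩
  obtain ⟨h1, h2⟩ := harmonic_nonneg_le k
  rw [coeffB, abs_mul, abs_mul, abs_of_nonneg h1, abs_of_nonneg (by positivity : (0 : ℝ) ≤ 2 * k)]
  gcongr
  linarith

/-- The entire function `u ↦ I_0(e^u)`. -/
noncomputable def expI (u : ℂ) : ℂ := expSeries coeffI u

/-- The derivative of `expI`. -/
noncomputable def expI' (u : ℂ) : ℂ := expSeries (fun k => 2 * k * coeffI k) u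

/-- `log (e^u / 2) + γ`. -/
noncomputable def shiftedLog (u : ℂ) : ℂ := u - Real.log 2 + Real.eulerMascheroniConstant

/-- The entire function `u ↦ K_0(e^u) = -(log (e^u / 2) + γ) I_0(e^u) + ∑ H_k e^{2ku} / (4^k k!²)`. -/
noncomputable def expK (u : ℂ) : ℂ := -(shiftedLog u) * expI u + expSeries coeffB u

/-- The derivative of `expK`. -/
noncomputable def expK' (u : ℂ) : ℂ :=
  -(expI u) - shiftedLog u * expI' u + expSeries (fun k => 2 * k * coeffB k) u

lemma hasDerivAt_expI (u : ℂ) : HasDerivAt expI (expI' u) u := isRapid_coeffI.hasDerivAt u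

lemma hasDerivAt_shiftedLog (u : ℂ) : HasDerivAt shiftedLog 1 u :=
  ((hasDerivAt_id u).sub_const _).add_const _

lemma hasDerivAt_expK (u : ℂ) : HasDerivAt expK (expK' u) u := by
  refine (((hasDerivAt_shiftedLog u).neg.mul (hasDerivAt_expI u)).add
    (isRapid_coeffB.hasDerivAt u)).congr_deriv ?_
  rw [expK', Pi.neg_apply]; ring

lemma expSeries_coeffI_second (u : ℂ) :
    expSeries (fun k => 2 * k * (2 * k * coeffI k)) u = Complex.exp (2 * u) * expI u := by
  refine expSeries_shift isRapid_coeffI.two_mul_natCast_mul.two_mul_natCast_mul (by simp)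
    (fun k => ?_) u
  rw [← coeffI_succ k]; push_cast; ring

lemma hasDerivAt_expI' (u : ℂ) : HasDerivAt expI' (Complex.exp (2 * u) * expI u) u := by
  rw [← expSeries_coeffI_second]
  exact isRapid_coeffI.two_mul_natCast_mul.hasDerivAt u

lemma expSeries_coeffB_second (u : ℂ) :
    expSeries (fun k => 2 * k * (2 * k * coeffB k)) u =
      Complex.exp (2 * u) * expSeries coeffB u + 2 * expI' u := by
  have hI := isRapid_coeffI.two_mul_natCast_mul
  have hB := isRapid_coeffB.two_mul_natCast_mul.two_mul_natCast_mul
  have hI2 : IsRapid fun k : ℕ => (-2) * (2 * k * coeffI k) := by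
    obtain ⟨C, D, hC, hD, h⟩ := hI
    refine ⟨2 * C, D, by positivity, hD, fun k => ?_⟩
    rw [abs_mul, abs_neg, abs_two]
    linarith [h k]
  have hc : IsRapid fun k : ℕ => 2 * k * (2 * k * coeffB k) + (-2) * (2 * k * coeffI k) := by
    obtain ⟨C, D, hC, hD, h⟩ := hB
    obtain ⟨C', D', hC', hD', h'⟩ := hI2
    refine ⟨C + C', max D D', by positivity, le_max_of_le_left hD, fun k => ?_⟩
    refine (abs_add_le _ _).trans ?_
    rw [add_mul]
    refine add_le_add ((h k).trans ?_) ((h' k).trans ?_)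
    · gcongr; exact le_max_left _ _
    · gcongr; exact le_max_right _ _
  have key := expSeries_shift (a := coeffB) hc (by simp) (fun k => ?_) u
  · rw [expSeries_add hB hI2, expSeries_const_mul] at key
    rw [expI', ← key]; push_cast; ring
  · rw [coeffB, coeffB, harmonic_succ, ← coeffI_succ k]
    push_cast
    field_simp
    ring

/-- In the variable `u = log z` the modified Bessel equation of order `0` reads `f'' = e^{2u} f`. -/
lemma hasDerivAt_expK' (u : ℂ) : HasDerivAt expK' (Complex.exp (2 * u) * expK u) u := by
  refine (((hasDerivAt_expI u).neg.sub ((hasDerivAt_shiftedLog u).mul (hasDerivAt_expI' u))).add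
    (isRapid_coeffB.two_mul_natCast_mul.hasDerivAt u)).congr_deriv ?_
  rw [expSeries_coeffB_second, expK]
  ring

lemma expI_add_pi (u : ℂ) : expI (u + Real.pi * Complex.I) = expI u :=
  expSeries_add_pi_mul_I _ u

lemma expI'_add_pi (u : ℂ) : expI' (u + Real.pi * Complex.I) = expI' u :=
  expSeries_add_pi_mul_I _ u

lemma expK_add_pi (u : ℂ) :
    expK (u + Real.pi * Complex.I) = expK u - Real.pi * Complex.I * expI u := by
  rw [expK, expK, expI_add_pi, expSeries_add_pi_mul_I, shiftedLog, shiftedLog]; ring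

lemma expK'_add_pi (u : ℂ) :
    expK' (u + Real.pi * Complex.I) = expK' u - Real.pi * Complex.I * expI' u := by
  rw [expK', expK', expI_add_pi, expI'_add_pi, expSeries_add_pi_mul_I, shiftedLog, shiftedLog]
  ring

lemma expI_conj (u : ℂ) : expI (starRingEnd ℂ u) = starRingEnd ℂ (expI u) := expSeries_conj _ u

lemma expK_conj (u : ℂ) : expK (starRingEnd ℂ u) = starRingEnd ℂ (expK u) := by
  simp only [expK, shiftedLog, expI_conj, expSeries_conj, map_add, map_mul, map_neg, map_sub,
    Complex.conj_ofReal]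

lemma expI_wronskian (u : ℂ) : expI u * expK' u - expI' u * expK u = -1 := by
  set W : ℂ → ℂ := fun u => expI u * expK' u - expI' u * expK u with hW
  have hd : ∀ u, HasDerivAt W 0 u := fun u => by
    refine (((hasDerivAt_expI u).mul (hasDerivAt_expK' u)).sub
      ((hasDerivAt_expI' u).mul (hasDerivAt_expK u))).congr_deriv ?_
    ring
  have hconst : ∀ x y, W x = W y := is_const_of_deriv_eq_zero
    (fun u => (hd u).differentiableAt) (fun u => (hd u).deriv)
  -- The logarithmic terms cancel, which leaves a power series in `e^{2u}` with constant term `-1`.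
  have hform : ∀ u, W u = -(expI u) ^ 2 + expI u * expSeries (fun k => 2 * k * coeffB k) u
      - expI' u * expSeries coeffB u := fun u => by
    simp only [hW, expK, expK']; ring
  have hlim : Tendsto (fun s : ℝ => W s) atBot (𝓝 (-1)) := by
    simp_rw [hform]
    have hI := expSeries_tendsto_atBot isRapid_coeffI
    have hI' := expSeries_tendsto_atBot isRapid_coeffI.two_mul_natCast_mul
    have hB := expSeries_tendsto_atBot isRapid_coeffB
    have hB' := expSeries_tendsto_atBot isRapid_coeffB.two_mul_natCast_mul
    have := (((hI.pow 2).neg).add (hI.mul hB')).sub (hI'.mul hB)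
    refine Tendsto.congr (fun _ => rfl) (this.trans (le_of_eq ?_))
    norm_num [coeffI]
  have : (fun s : ℝ => W s) = fun _ => W u := funext fun s => hconst _ _
  rw [this] at hlim
  exact tendsto_nhds_unique tendsto_const_nhds hlim

/-! ### Derivatives with respect to the order -/

/-- The common form of the series of `J_ν` (`ε = -1`) and `I_ν` (`ε = 1`), with `l = log (z / 2)`. -/
noncomputable def orderSeries (ε l ν : ℂ) : ℂ :=
  ∑' k : ℕ, ε ^ k / ((k.factorial : ℂ) * Complex.Gamma (k + ν + 1)) * Complex.exp (l * (2 * k + ν))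

lemma norm_inv_Gamma_add_natCast_le {M : ℝ} {ν : ℂ} (hν : ‖ν‖ ≤ 1 / 2)
    (hM : ‖(Complex.Gamma (ν + 1))⁻¹‖ ≤ M) (k : ℕ) :
    ‖(Complex.Gamma (k + ν + 1))⁻¹‖ ≤ M * 2 ^ k := by
  induction k with
  | zero => simpa using hM
  | succ k ih =>
    have hre : 1 / 2 ≤ ((k : ℂ) + ν + 1).re := by
      have := (abs_le.1 ((Complex.abs_re_le_norm ν).trans hν)).1
      simp only [Complex.add_re, Complex.natCast_re, Complex.one_re]
      linarith [k.cast_nonneg (α := ℝ)]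
    have hn : 1 / 2 ≤ ‖(k : ℂ) + ν + 1‖ := hre.trans (Complex.re_le_norm _)
    have h := Complex.one_div_Gamma_eq_self_mul_one_div_Gamma_add_one ((k : ℂ) + ν + 1)
    rw [h, norm_mul] at ih
    have e : ((k + 1 : ℕ) : ℂ) + ν + 1 = (k : ℂ) + ν + 1 + 1 := by push_cast; ring
    rw [e, pow_succ]
    nlinarith [norm_nonneg (Complex.Gamma ((k : ℂ) + ν + 1 + 1))⁻¹]

lemma hasDerivAt_orderSeries_term (ε l : ℂ) (k : ℕ) :
    HasDerivAt (fun ν : ℂ => ε ^ k / ((k.factorial : ℂ) * Complex.Gamma (k + ν + 1)) *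
        Complex.exp (l * (2 * k + ν)))
      (ε ^ k / (k.factorial : ℂ) ^ 2 * Complex.exp (2 * k * l) *
        (l - (harmonic k - Real.eulerMascheroniConstant))) 0 := by
  have hf : (k.factorial : ℂ) ≠ 0 := by exact_mod_cast k.factorial_ne_zero
  have hG0 : Complex.Gamma (k + 0 + 1) = k.factorial := by
    rw [add_zero, Complex.Gamma_nat_eq_factorial]
  have hG : HasDerivAt (fun ν : ℂ => Complex.Gamma (k + ν + 1))
      (k.factorial * (-Real.eulerMascheroniConstant + harmonic k)) 0 := by
    have h := Complex.hasDerivAt_Gamma_nat k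
    have h2 : HasDerivAt (fun ν : ℂ => (k : ℂ) + ν + 1) 1 0 :=
      ((hasDerivAt_id _).const_add _).add_const _
    have h' : HasDerivAt Complex.Gamma (k.factorial * (-Real.eulerMascheroniConstant + harmonic k))
        ((k : ℂ) + 0 + 1) := by simpa using h
    exact (h'.comp (0 : ℂ) h2).congr_deriv (mul_one _)
  have hE : HasDerivAt (fun ν : ℂ => Complex.exp (l * (2 * k + ν)))
      (Complex.exp (l * (2 * k + 0)) * (l * 1)) 0 :=
    (((hasDerivAt_id _).const_add _).const_mul l).cexp
  have hQ := ((hasDerivAt_const (0 : ℂ) (ε ^ k)).div (hG.const_mul (k.factorial : ℂ))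
    (by rw [hG0]; exact mul_ne_zero hf hf)).mul hE
  refine hQ.congr_deriv ?_
  simp only [Pi.div_apply, hG0]
  rw [show l * (2 * (k : ℂ) + 0) = 2 * k * l by ring]
  field_simp
  ring

lemma hasDerivAt_orderSeries {ε : ℂ} (hε : ‖ε‖ = 1) (l : ℂ) :
    HasDerivAt (orderSeries ε l) (∑' k : ℕ, ε ^ k / (k.factorial : ℂ) ^ 2 *
      Complex.exp (2 * k * l) * (l - (harmonic k - Real.eulerMascheroniConstant))) 0 := by
  obtain ⟨M, hM⟩ : ∃ M, ∀ ν ∈ Metric.closedBall (0 : ℂ) (1 / 2),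
      ‖(Complex.Gamma (ν + 1))⁻¹‖ ≤ M :=
    (isCompact_closedBall (0 : ℂ) (1 / 2)).exists_bound_of_continuousOn
      (f := fun ν => (Complex.Gamma (ν + 1))⁻¹)
      ((Complex.differentiable_one_div_Gamma.continuous.comp
        (continuous_id.add continuous_const)).continuousOn)
  have hM0 : 0 ≤ M := (norm_nonneg _).trans (hM 0 (by simp))
  set u : ℕ → ℝ := fun k => M * Real.exp ‖l‖ * ((2 * Real.exp (2 * ‖l‖)) ^ k / k.factorial) with hu
  have hus : Summable u := (Real.summable_pow_div_factorial _).mul_left _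
  have hdiff : ∀ k : ℕ, DifferentiableOn ℂ (fun ν : ℂ =>
      ε ^ k / ((k.factorial : ℂ) * Complex.Gamma (k + ν + 1)) * Complex.exp (l * (2 * k + ν)))
      (Metric.ball 0 (1 / 2)) := fun k => by
    have h1 : Differentiable ℂ fun ν : ℂ => (Complex.Gamma (k + ν + 1))⁻¹ :=
      Complex.differentiable_one_div_Gamma.comp (by fun_prop)
    have : Differentiable ℂ fun ν : ℂ => ε ^ k / (k.factorial : ℂ) *
        (Complex.Gamma (k + ν + 1))⁻¹ * Complex.exp (l * (2 * k + ν)) := by fun_prop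
    refine this.differentiableOn.congr fun ν _ => ?_
    rw [div_mul_eq_div_div, div_eq_mul_inv _ (Complex.Gamma _)]
  have hle : ∀ (k : ℕ) (ν : ℂ), ν ∈ Metric.ball (0 : ℂ) (1 / 2) →
      ‖ε ^ k / ((k.factorial : ℂ) * Complex.Gamma (k + ν + 1)) *
        Complex.exp (l * (2 * k + ν))‖ ≤ u k := fun k ν hν => by
    have hν' : ‖ν‖ ≤ 1 / 2 := (mem_ball_zero_iff.1 hν).le
    have h1 := norm_inv_Gamma_add_natCast_le hν' (hM ν (Metric.ball_subset_closedBall hν)) k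
    have h2 : ‖Complex.exp (l * (2 * k + ν))‖ ≤ Real.exp ‖l‖ * Real.exp (2 * ‖l‖) ^ k := by
      refine (Complex.norm_exp_le_exp_norm _).trans ?_
      rw [← Real.exp_nat_mul, ← Real.exp_add, Real.exp_le_exp, norm_mul]
      have : ‖(2 : ℂ) * k + ν‖ ≤ 2 * k + 1 := by
        refine (norm_add_le _ _).trans ?_
        rw [norm_mul, Complex.norm_natCast, Complex.norm_ofNat]
        linarith
      nlinarith [norm_nonneg l]
    rw [norm_mul, norm_div, norm_pow, hε, one_pow, norm_mul, Complex.norm_natCast, one_div,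
      mul_inv, ← norm_inv (Complex.Gamma _)]
    calc (k.factorial : ℝ)⁻¹ * ‖(Complex.Gamma (k + ν + 1))⁻¹‖ * ‖Complex.exp (l * (2 * k + ν))‖
        ≤ (k.factorial : ℝ)⁻¹ * (M * 2 ^ k) * (Real.exp ‖l‖ * Real.exp (2 * ‖l‖) ^ k) := by
          gcongr
      _ = u k := by simp only [hu]; rw [mul_pow]; ring
  have h0 : (0 : ℂ) ∈ Metric.ball (0 : ℂ) (1 / 2) := Metric.mem_ball_self (by norm_num)
  have hsum := Complex.hasSum_deriv_of_summable_norm hus hdiff Metric.isOpen_ball hle h0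
  have hd := ((Complex.differentiableOn_tsum_of_summable_norm hus hdiff Metric.isOpen_ball
    hle).differentiableAt (Metric.isOpen_ball.mem_nhds h0)).hasDerivAt
  simp_rw [fun k => (hasDerivAt_orderSeries_term ε l k).deriv] at hsum
  rw [hsum.tsum_eq]
  exact hd

lemma orderSeries_term_eq {ε l v : ℂ}
    (h : ∀ k : ℕ, ε ^ k * Complex.exp (2 * k * l) = Complex.exp (2 * k * v) / 4 ^ k) (k : ℕ) :
    ε ^ k / (k.factorial : ℂ) ^ 2 * Complex.exp (2 * k * l) =
      coeffI k * Complex.exp (2 * k * v) := by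
  rw [div_mul_eq_mul_div, h, coeffI]
  push_cast
  field_simp

lemma orderSeries_zero {ε l v : ℂ}
    (h : ∀ k : ℕ, ε ^ k * Complex.exp (2 * k * l) = Complex.exp (2 * k * v) / 4 ^ k) :
    orderSeries ε l 0 = expI v := by
  refine tsum_congr fun k => ?_
  rw [← orderSeries_term_eq h, add_zero, Complex.Gamma_nat_eq_factorial, ← pow_two, add_zero,
    mul_comm l]

lemma hasDerivAt_orderSeries_expI {ε l v : ℂ} (hε : ‖ε‖ = 1)
    (h : ∀ k : ℕ, ε ^ k * Complex.exp (2 * k * l) = Complex.exp (2 * k * v) / 4 ^ k) :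
    HasDerivAt (orderSeries ε l)
      ((l + Real.eulerMascheroniConstant) * expI v - expSeries coeffB v) 0 := by
  convert hasDerivAt_orderSeries hε l using 1
  rw [expI, expSeries, expSeries, ← tsum_mul_left,
    ← ((isRapid_coeffI.summable v).mul_left _).tsum_sub (isRapid_coeffB.summable v)]
  refine tsum_congr fun k => ?_
  rw [orderSeries_term_eq h, coeffB]
  push_cast
  ring

lemma tendsto_div_of_hasDerivAt_zero {f g : ℂ → ℂ} {f' g' : ℂ} (hf : HasDerivAt f f' 0)
    (hg : HasDerivAt g g' 0) (hf0 : f 0 = 0) (hg0 : g 0 = 0) (hg' : g' ≠ 0) :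
    Tendsto (fun μ => f μ / g μ) (𝓝[≠] 0) (𝓝 (f' / g')) := by
  have h := (hasDerivAt_iff_tendsto_slope_zero.1 hf).div (hasDerivAt_iff_tendsto_slope_zero.1 hg)
    hg'
  refine h.congr' ?_
  filter_upwards [self_mem_nhdsWithin] with μ hμ
  simp only [zero_add, hf0, hg0, sub_zero, smul_eq_mul, Pi.div_apply]
  exact mul_div_mul_left _ _ (inv_ne_zero hμ)

lemma hasDerivAt_sin_mul_pi :
    HasDerivAt (fun μ : ℂ => Complex.sin (μ * Real.pi)) Real.pi 0 := by
  have := ((hasDerivAt_id (0 : ℂ)).mul_const (Real.pi : ℂ)).csin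
  simpa using this

lemma hasDerivAt_cos_mul_pi :
    HasDerivAt (fun μ : ℂ => Complex.cos (μ * Real.pi)) 0 0 := by
  have := ((hasDerivAt_id (0 : ℂ)).mul_const (Real.pi : ℂ)).ccos
  simpa using this

lemma hasDerivAt_comp_neg_zero {f : ℂ → ℂ} {f' : ℂ} (hf : HasDerivAt f f' 0) :
    HasDerivAt (fun μ => f (-μ)) (-f') 0 := by
  have h : HasDerivAt f f' (-(0 : ℂ)) := by simpa using hf
  exact (h.comp (0 : ℂ) (hasDerivAt_neg (0 : ℂ))).congr_deriv (by ring)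

lemma limUnder_second_kind_K {f : ℂ → ℂ} {f' : ℂ} (hf : HasDerivAt f f' 0) :
    (Real.pi : ℂ) / 2 * limUnder (𝓝[≠] (0 : ℂ)) (fun μ : ℂ =>
      (f (-μ) - f μ) / Complex.sin (μ * Real.pi)) = -f' := by
  have hpi : (Real.pi : ℂ) ≠ 0 := by exact_mod_cast Real.pi_ne_zero
  have h := tendsto_div_of_hasDerivAt_zero ((hasDerivAt_comp_neg_zero hf).sub hf)
    hasDerivAt_sin_mul_pi (by simp) (by simp) hpi
  have h' : Tendsto (fun μ : ℂ => (f (-μ) - f μ) / Complex.sin (μ * Real.pi)) (𝓝[≠] (0 : ℂ))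
    (𝓝 ((-f' - f') / Real.pi)) := h
  rw [h'.limUnder_eq]
  field_simp
  ring

lemma limUnder_second_kind_Y {f : ℂ → ℂ} {f' : ℂ} (hf : HasDerivAt f f' 0) :
    limUnder (𝓝[≠] (0 : ℂ)) (fun μ : ℂ =>
      (f μ * Complex.cos (μ * Real.pi) - f (-μ)) / Complex.sin (μ * Real.pi)) =
      2 / Real.pi * f' := by
  have hpi : (Real.pi : ℂ) ≠ 0 := by exact_mod_cast Real.pi_ne_zero
  have h := tendsto_div_of_hasDerivAt_zero
    ((hf.mul hasDerivAt_cos_mul_pi).sub (hasDerivAt_comp_neg_zero hf))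
    hasDerivAt_sin_mul_pi (by simp) (by simp) hpi
  have h' : Tendsto (fun μ : ℂ => (f μ * Complex.cos (μ * Real.pi) - f (-μ)) /
    Complex.sin (μ * Real.pi)) (𝓝[≠] (0 : ℂ)) (𝓝 _) := h
  rw [h'.limUnder_eq]
  simp
  ring

lemma besselI_eq_orderSeries {z : ℂ} (hz : z ≠ 0) (ν : ℂ) :
    besselI ν z = orderSeries 1 (Complex.log (z / 2)) ν := by
  refine tsum_congr fun k => ?_
  rw [one_pow, Complex.cpow_def_of_ne_zero (by simpa using hz)]

lemma besselJ_eq_orderSeries {z : ℂ} (hz : z ≠ 0) (ν : ℂ) :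
    besselJ ν z = orderSeries (-1) (Complex.log (z / 2)) ν := by
  refine tsum_congr fun k => ?_
  rw [Complex.cpow_def_of_ne_zero (by simpa using hz)]

lemma log_half {z : ℂ} (hz : z ≠ 0) : Complex.log (z / 2) = Complex.log z - Real.log 2 := by
  have h := Complex.log_ofReal_mul (r := 2) (x := z / 2) (by norm_num) (by simpa using hz)
  rw [Complex.ofReal_ofNat, mul_div_cancel₀ z two_ne_zero] at h
  rw [h]; ring

lemma exp_two_mul_natCast_mul_log_half {z : ℂ} (hz : z ≠ 0) (k : ℕ) :
    Complex.exp (2 * k * Complex.log (z / 2)) = Complex.exp (2 * k * Complex.log z) / 4 ^ k := by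
  rw [log_half hz, mul_sub, Complex.exp_sub]
  congr 1
  rw [show (2 : ℂ) * k * Real.log 2 = k * ((2 * Real.log 2 : ℝ) : ℂ) by push_cast; ring,
    Complex.exp_nat_mul, ← Complex.ofReal_exp, two_mul, Real.exp_add,
    Real.exp_log (by norm_num)]
  norm_num

lemma exp_series_I {z : ℂ} (hz : z ≠ 0) (k : ℕ) :
    (1 : ℂ) ^ k * Complex.exp (2 * k * Complex.log (z / 2)) =
      Complex.exp (2 * k * Complex.log z) / 4 ^ k := by
  rw [one_pow, one_mul, exp_two_mul_natCast_mul_log_half hz]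

lemma exp_series_J {z : ℂ} (hz : z ≠ 0) (k : ℕ) :
    (-1 : ℂ) ^ k * Complex.exp (2 * k * Complex.log (z / 2)) =
      Complex.exp (2 * k * (Complex.log z + Real.pi / 2 * Complex.I)) / 4 ^ k := by
  rw [exp_two_mul_natCast_mul_log_half hz, show (2 : ℂ) * k * (Complex.log z +
    Real.pi / 2 * Complex.I) = 2 * k * Complex.log z + k * (Real.pi * Complex.I) by ring,
    Complex.exp_add, Complex.exp_nat_mul, Complex.exp_pi_mul_I]
  ring

lemma besselI_zero_eq {z : ℂ} (hz : z ≠ 0) : besselI 0 z = expI (Complex.log z) := by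
  rw [besselI_eq_orderSeries hz, orderSeries_zero (exp_series_I hz)]

lemma besselK_zero_eq {z : ℂ} (hz : z ≠ 0) : besselK 0 z = expK (Complex.log z) := by
  unfold besselK
  simp_rw [besselI_eq_orderSeries hz]
  rw [limUnder_second_kind_K (hasDerivAt_orderSeries_expI norm_one (exp_series_I hz)),
    log_half hz, expK, shiftedLog]
  ring

lemma besselJ_zero_eq {z : ℂ} (hz : z ≠ 0) :
    besselJ 0 z = expI (Complex.log z + Real.pi / 2 * Complex.I) := by
  rw [besselJ_eq_orderSeries hz, orderSeries_zero (exp_series_J hz)]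

lemma besselY_zero_eq {z : ℂ} (hz : z ≠ 0) :
    besselY 0 z = -(2 / Real.pi) * expK (Complex.log z + Real.pi / 2 * Complex.I)
      - Complex.I * expI (Complex.log z + Real.pi / 2 * Complex.I) := by
  have hpi : (Real.pi : ℂ) ≠ 0 := by exact_mod_cast Real.pi_ne_zero
  unfold besselY
  simp_rw [besselJ_eq_orderSeries hz]
  rw [limUnder_second_kind_Y (hasDerivAt_orderSeries_expI (by simp) (exp_series_J hz)),
    log_half hz, expK, shiftedLog]
  field_simp
  ring

/-- `(π / 2)² H_0^{(1)}(e^u) H_0^{(2)}(e^u)`, by the connection formulas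
`H_0^{(1)}(e^u) = -(2i/π) K_0(e^{u - iπ/2})` and `H_0^{(2)}(e^u) = (2i/π) K_0(e^{u + iπ/2})`. -/
noncomputable def hankelProd (u : ℂ) : ℂ :=
  expK (u - Real.pi / 2 * Complex.I) * expK (u + Real.pi / 2 * Complex.I)

lemma expK_sub_half_pi (u : ℂ) : expK (u - Real.pi / 2 * Complex.I) =
    expK (u + Real.pi / 2 * Complex.I)
      + Real.pi * Complex.I * expI (u + Real.pi / 2 * Complex.I) := by
  have h1 := expK_add_pi (u - Real.pi / 2 * Complex.I)
  have h2 := expI_add_pi (u - Real.pi / 2 * Complex.I)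
  rw [show u - Real.pi / 2 * Complex.I + Real.pi * Complex.I = u + Real.pi / 2 * Complex.I by
    ring] at h1 h2
  rw [h1, h2]; ring

lemma hankel_mul_eq {z : ℂ} (hz : z ≠ 0) :
    ((Real.pi : ℂ) / 2) ^ 2 * (hankelOne z * hankelTwo z) = hankelProd (Complex.log z) := by
  have hpi : (Real.pi : ℂ) ≠ 0 := by exact_mod_cast Real.pi_ne_zero
  rw [hankelOne, hankelTwo, besselJ_zero_eq hz, besselY_zero_eq hz, hankelProd, expK_sub_half_pi]
  generalize expK _ = K
  generalize expI _ = J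
  field_simp
  linear_combination -(4 * K ^ 2 + J ^ 2 * Real.pi ^ 2 * (Complex.I ^ 2 - 1)
    + 4 * Complex.I * J * K * Real.pi) * Complex.I_sq

/-! ### `I_0` and `K_0` on the positive half-line -/

/-- `I_0(e^s)` as a real number. -/
noncomputable def realI (s : ℝ) : ℝ := (expI s).re

/-- The derivative of `realI`. -/
noncomputable def realI' (s : ℝ) : ℝ := (expI' s).re

/-- `K_0(e^s)` as a real number. -/
noncomputable def realK (s : ℝ) : ℝ := (expK s).re

/-- The derivative of `realK`. -/
noncomputable def realK' (s : ℝ) : ℝ := (expK' s).re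

lemma expI_ofReal (s : ℝ) : expI s = realI s :=
  (Complex.conj_eq_iff_re.1 (by rw [← expI_conj, Complex.conj_ofReal])).symm

lemma expK_ofReal (s : ℝ) : expK s = realK s :=
  (Complex.conj_eq_iff_re.1 (by rw [← expK_conj, Complex.conj_ofReal])).symm

lemma exp_two_mul_ofReal (s : ℝ) : Complex.exp (2 * s) = (Real.exp s ^ 2 : ℝ) := by
  rw [← Real.exp_nat_mul]; push_cast; rfl

lemma hasDerivAt_realI (s : ℝ) : HasDerivAt realI (realI' s) s :=
  (hasDerivAt_expI s).real_of_complex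

lemma hasDerivAt_realK (s : ℝ) : HasDerivAt realK (realK' s) s :=
  (hasDerivAt_expK s).real_of_complex

lemma hasDerivAt_realI' (s : ℝ) : HasDerivAt realI' (Real.exp s ^ 2 * realI s) s := by
  refine (hasDerivAt_expI' s).real_of_complex.congr_deriv ?_
  rw [expI_ofReal, exp_two_mul_ofReal, ← Complex.ofReal_mul, Complex.ofReal_re]

lemma IsRapid.hasSum_re {a : ℕ → ℝ} (ha : IsRapid a) (s : ℝ) :
    HasSum (fun k => a k * Real.exp s ^ (2 * k)) (expSeries a s).re := by
  rw [expSeries_ofReal, Complex.ofReal_re]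
  refine Summable.hasSum (Summable.of_norm ?_)
  refine (ha.summable_abs (Real.exp_pos s).le).congr fun k => ?_
  rw [Real.norm_eq_abs, abs_mul, abs_of_pos (pow_pos (Real.exp_pos s) _)]

lemma hasSum_realI (s : ℝ) : HasSum (fun k => coeffI k * Real.exp s ^ (2 * k)) (realI s) :=
  isRapid_coeffI.hasSum_re s

lemma hasSum_realI' (s : ℝ) :
    HasSum (fun k : ℕ => 2 * k * coeffI k * Real.exp s ^ (2 * k)) (realI' s) :=
  isRapid_coeffI.two_mul_natCast_mul.hasSum_re s

lemma realI_wronskian (s : ℝ) : realI s * realK' s - realI' s * realK s = -1 := by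
  have h := congrArg Complex.re (expI_wronskian s)
  rw [expI_ofReal, expK_ofReal] at h
  simpa [realI', realK', mul_comm] using h

lemma coeffI_mul_exp_le_realI (k : ℕ) (s : ℝ) : coeffI k * Real.exp s ^ (2 * k) ≤ realI s :=
  le_hasSum (hasSum_realI s) k fun j _ => by have := coeffI_pos j; positivity

lemma one_le_realI (s : ℝ) : 1 ≤ realI s := by
  simpa [coeffI] using coeffI_mul_exp_le_realI 0 s

lemma realI'_pos (s : ℝ) : 0 < realI' s := by
  have := le_hasSum (hasSum_realI' s) 1 fun j _ => by have := coeffI_pos j; positivity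
  refine lt_of_lt_of_le ?_ this
  have := coeffI_pos 1
  positivity

lemma two_mul_realI_sub_one_le (s : ℝ) : 2 * (realI s - 1) ≤ realI' s := by
  have h1 : HasSum (fun k => if k = 0 then (1 : ℝ) else 0) 1 := hasSum_ite_eq 0 1
  refine hasSum_le (fun k => ?_) (((hasSum_realI s).sub h1).mul_left 2) (hasSum_realI' s)
  rcases Nat.eq_zero_or_pos k with rfl | hk
  · simp [coeffI]
  · rw [if_neg hk.ne', sub_zero]
    have : (1 : ℝ) ≤ k := by exact_mod_cast hk
    have h2 : 0 < coeffI k * Real.exp s ^ (2 * k) := by have := coeffI_pos k; positivity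
    nlinarith

lemma realI_le_realI' {s : ℝ} (hs : 0 ≤ s) : realI s ≤ 5 / 2 * realI' s := by
  have h := coeffI_mul_exp_le_realI 0 s
  have h2 : 5 / 4 ≤ realI s := by
    have h3 := sum_le_hasSum (Finset.range 2) (fun j _ => by have := coeffI_pos j; positivity)
      (hasSum_realI s)
    have h4 : 1 ≤ Real.exp s := Real.one_le_exp hs
    rw [Finset.sum_range_succ, Finset.sum_range_one] at h3
    norm_num [coeffI] at h3
    nlinarith
  linarith [two_mul_realI_sub_one_le s]

lemma log_add_one_sub_le_harmonic (k : ℕ) :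
    Real.log (k + 1) - 1 / (k + 1) ≤ harmonic k - Real.eulerMascheroniConstant ∧
      harmonic k - Real.eulerMascheroniConstant ≤ Real.log (k + 1) := by
  have h1 := Real.eulerMascheroniSeq_lt_eulerMascheroniConstant k
  have h2 := Real.eulerMascheroniConstant_lt_eulerMascheroniSeq' (k + 1)
  rw [Real.eulerMascheroniSeq] at h1
  rw [Real.eulerMascheroniSeq', if_neg (Nat.succ_ne_zero k), harmonic_succ] at h2
  push_cast at h2
  rw [one_div]
  constructor <;> linarith

lemma hasSum_realK (s : ℝ) : HasSum (fun k : ℕ => coeffI k * Real.exp s ^ (2 * k) *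
    (harmonic k - Real.eulerMascheroniConstant - Real.log (Real.exp s / 2))) (realK s) := by
  have h := (isRapid_coeffB.hasSum_re s).sub ((hasSum_realI s).mul_left
    (Real.eulerMascheroniConstant + Real.log (Real.exp s / 2)))
  rw [Real.log_div (Real.exp_ne_zero _) two_ne_zero, Real.log_exp] at h ⊢
  have e : realK s = (expSeries coeffB s).re -
      (Real.eulerMascheroniConstant + (s - Real.log 2)) * realI s := by
    have : shiftedLog s = ((s - Real.log 2 + Real.eulerMascheroniConstant : ℝ) : ℂ) := by
      rw [shiftedLog]; push_cast; rfl
    rw [realK, expK, this, expI_ofReal, Complex.add_re, ← Complex.ofReal_neg,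
      ← Complex.ofReal_mul, Complex.ofReal_re]
    ring
  rw [e]
  refine h.congr_fun fun k => ?_
  rw [coeffB]; ring

lemma hasSum_sq_mul (s : ℝ) : HasSum (fun k : ℕ => (k : ℝ) ^ 2 * (coeffI k * Real.exp s ^ (2 * k)))
    ((Real.exp s / 2) ^ 2 * realI s) := by
  have h := (isRapid_coeffI.two_mul_natCast_mul.two_mul_natCast_mul.hasSum_re s).mul_left (1 / 4)
  rw [expSeries_coeffI_second, expI_ofReal, exp_two_mul_ofReal, ← Complex.ofReal_mul,
    Complex.ofReal_re] at h
  rw [show (Real.exp s / 2) ^ 2 * realI s = 1 / 4 * (Real.exp s ^ 2 * realI s) by ring]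
  exact h.congr_fun fun k => by ring

lemma hasSum_div_sq (s : ℝ) :
    HasSum (fun k : ℕ => (Real.exp s / 2) ^ 2 / ((k : ℝ) + 1) ^ 2 *
      (coeffI k * Real.exp s ^ (2 * k))) (realI s - 1) := by
  have h := (hasSum_nat_add_iff' 1).2 (hasSum_realI s)
  rw [Finset.sum_range_one] at h
  have e : coeffI 0 * Real.exp s ^ (2 * 0) = 1 := by simp [coeffI]
  rw [e] at h
  refine h.congr_fun fun k => ?_
  rw [← coeffI_succ k]
  field_simp
  ring

/-- The ratio `K_0 / I_0` is the mean of `H_k - γ - log τ`, `τ = z / 2`, for the weights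
`τ^{2k} / k!²`. Since `H_k - γ` is close to `log (k + 1)` and `log x ≤ x - 1`, it is at most
half the mean of `(k + 1)² / τ² - 1`, and the mean of `k² / τ²` is exactly `1`. -/
lemma realK_le (s : ℝ) :
    realK s ≤ (1 / (Real.exp s / 2) + 1 / 2 / (Real.exp s / 2) ^ 2) * realI s := by
  set τ : ℝ := Real.exp s / 2 with hτ
  have hτ0 : 0 < τ := by positivity
  have hsum := ((hasSum_sq_mul s).mul_left ((1 + 1 / τ) / (2 * τ ^ 2))).add
    ((hasSum_realI s).mul_left (((τ + 1) / τ ^ 2 - 1) / 2))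
  refine (hasSum_le (fun k => ?_) (hasSum_realK s) hsum).trans (le_of_eq ?_)
  · have hp : 0 < coeffI k * Real.exp s ^ (2 * k) := by have := coeffI_pos k; positivity
    have h1 := (log_add_one_sub_le_harmonic k).2
    have h2 : Real.log (k + 1) - Real.log τ ≤ (((k : ℝ) + 1) ^ 2 / τ ^ 2 - 1) / 2 := by
      rw [← Real.log_div (by positivity) hτ0.ne']
      have := Real.log_le_sub_one_of_pos (x := (((k : ℝ) + 1) / τ) ^ 2) (by positivity)
      rw [Real.log_pow, div_pow] at this
      push_cast at this
      linarith
    have h3 : ((k : ℝ) + 1) ^ 2 / τ ^ 2 ≤ ((1 + 1 / τ) * k ^ 2 + (τ + 1)) / τ ^ 2 := by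
      gcongr
      have : 2 * (k : ℝ) ≤ 1 / τ * k ^ 2 + τ := by
        have : 0 ≤ (k - τ) ^ 2 / τ := by positivity
        have e : (k - τ) ^ 2 / τ = 1 / τ * k ^ 2 + τ - 2 * k := by field_simp; ring
        linarith
      linarith
    calc _ ≤ coeffI k * Real.exp s ^ (2 * k) *
          ((((1 + 1 / τ) * k ^ 2 + (τ + 1)) / τ ^ 2 - 1) / 2) :=
          mul_le_mul_of_nonneg_left (by linarith) hp.le
      _ = _ := by field_simp; ring
  · rw [← hτ]; field_simp; ring

/-- The companion lower bound, from `log x ≥ 1 - 1/x` and the mean of `τ² / (k + 1)²`, which is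
`1 - 1 / I_0` by a shift of the index. -/
lemma neg_le_realK (s : ℝ) : -(1 / (Real.exp s / 2) * realI s) ≤ realK s := by
  set τ : ℝ := Real.exp s / 2 with hτ
  have hτ0 : 0 < τ := by positivity
  have hsum := ((hasSum_realI s).mul_left ((1 - 1 / τ) / 2)).sub
    ((hasSum_div_sq s).mul_left ((1 + 1 / τ) / 2))
  refine le_trans ?_ (hasSum_le (fun k => ?_) hsum (hasSum_realK s))
  · have : 0 < 1 / τ := by positivity
    nlinarith [one_le_realI s]
  · have hp : 0 < coeffI k * Real.exp s ^ (2 * k) := by have := coeffI_pos k; positivity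
    have h1 := (log_add_one_sub_le_harmonic k).1
    have h2 : (1 - τ ^ 2 / ((k : ℝ) + 1) ^ 2) / 2 ≤ Real.log (k + 1) - Real.log τ := by
      rw [← Real.log_div (by positivity) hτ0.ne']
      have := Real.log_le_sub_one_of_pos (x := (τ / ((k : ℝ) + 1)) ^ 2) (by positivity)
      rw [← inv_div, inv_pow, Real.log_inv, Real.log_pow, ← inv_pow, inv_div, div_pow] at this
      push_cast at this
      linarith
    have h3 : 1 / ((k : ℝ) + 1) ≤ (1 / τ + τ / ((k : ℝ) + 1) ^ 2) / 2 := by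
      have : 0 ≤ (k + 1 - τ) ^ 2 / (τ * ((k : ℝ) + 1) ^ 2) := by positivity
      have e : (k + 1 - τ) ^ 2 / (τ * ((k : ℝ) + 1) ^ 2) =
        1 / τ + τ / ((k : ℝ) + 1) ^ 2 - 2 * (1 / ((k : ℝ) + 1)) := by field_simp; ring
      linarith
    calc _ = coeffI k * Real.exp s ^ (2 * k) * ((1 - τ ^ 2 / ((k : ℝ) + 1) ^ 2) / 2 -
          (1 / τ + τ / ((k : ℝ) + 1) ^ 2) / 2) := by rw [← hτ]; field_simp; ring
      _ ≤ _ := mul_le_mul_of_nonneg_left (by linarith) hp.le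

lemma tendsto_realK_div_realI : Tendsto (fun s => realK s / realI s) atTop (𝓝 0) := by
  have hinv : Tendsto (fun s => 1 / (Real.exp s / 2)) atTop (𝓝 0) := by
    simp_rw [one_div]
    exact (Real.tendsto_exp_atTop.atTop_div_const two_pos).inv_tendsto_atTop
  have hup : Tendsto (fun s => 1 / (Real.exp s / 2) + 1 / 2 / (Real.exp s / 2) ^ 2) atTop (𝓝 0) := by
    have := hinv.add ((hinv.pow 2).const_mul (1 / 2))
    simp only [zero_pow two_ne_zero, mul_zero, add_zero] at this
    refine this.congr fun s => ?_
    rw [div_pow, one_pow]; ring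
  have hlow : Tendsto (fun s => -(1 / (Real.exp s / 2))) atTop (𝓝 0) := by simpa using hinv.neg
  refine tendsto_of_tendsto_of_tendsto_of_le_of_le hlow hup (fun s => ?_) (fun s => ?_)
  · have h := neg_le_realK s
    have := one_le_realI s
    rw [le_div_iff₀ (by linarith)]; linarith
  · have h := realK_le s
    have := one_le_realI s
    change realK s / realI s ≤ _
    rwa [div_le_iff₀ (by linarith)]

/-- `K_0 / I_0` decreases to `0`, its derivative being `-1 / I_0²` by the Wronskian. -/
lemma realK_nonneg (s : ℝ) : 0 ≤ realK s := by
  have hpos : ∀ s, 0 < realI s := fun s => lt_of_lt_of_le one_pos (one_le_realI s)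
  have hanti : Antitone fun s => realK s / realI s := by
    have hd : ∀ s, HasDerivAt (fun s => realK s / realI s) (-1 / realI s ^ 2) s := fun s => by
      refine ((hasDerivAt_realK s).div (hasDerivAt_realI s) (hpos s).ne').congr_deriv ?_
      rw [← realI_wronskian s]; ring
    refine antitone_of_deriv_nonpos (fun s => (hd s).differentiableAt) fun s => ?_
    rw [(hd s).deriv]
    have := hpos s
    exact div_nonpos_of_nonpos_of_nonneg (by norm_num) (by positivity)
  have := hanti.le_of_tendsto tendsto_realK_div_realI s
  have h := mul_nonneg this (hpos s).le
  rwa [div_mul_cancel₀ _ (hpos s).ne'] at h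

/-- `K_0 / I_0 - 1 / (I_0 I_0')` increases to a limit that is at most `0`. -/
lemma realK_mul_realI'_le (s : ℝ) : realK s * realI' s ≤ 1 := by
  have hpos : ∀ s, 0 < realI s := fun s => lt_of_lt_of_le one_pos (one_le_realI s)
  have hpos' := realI'_pos
  set φ : ℝ → ℝ := fun s => realK s / realI s - 1 / (realI s * realI' s) with hφ
  have hd : ∀ s, HasDerivAt φ (Real.exp s ^ 2 / realI' s ^ 2) s := fun s => by
    have h1 := hpos s
    have h2 := hpos' s
    refine (((hasDerivAt_realK s).div (hasDerivAt_realI s) h1.ne').sub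
      ((hasDerivAt_const s (1 : ℝ)).div ((hasDerivAt_realI s).mul (hasDerivAt_realI' s))
        (mul_pos h1 h2).ne')).congr_deriv ?_
    have hw : realK' s * realI s = realI' s * realK s - 1 := by linarith [realI_wronskian s]
    rw [hw]
    simp only [Pi.mul_apply]
    field_simp
    ring
  have hmono : Monotone φ := by
    refine monotone_of_deriv_nonneg (fun s => (hd s).differentiableAt) fun s => ?_
    rw [(hd s).deriv]; positivity
  have hle : φ s ≤ 0 := by
    refine le_of_tendsto_of_tendsto tendsto_const_nhds tendsto_realK_div_realI ?_
    filter_upwards [eventually_ge_atTop s] with t ht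
    have : 0 < 1 / (realI t * realI' t) := by have := hpos t; have := hpos' t; positivity
    have := hmono ht
    simp only [hφ] at this ⊢
    linarith
  have h1 := hpos s
  have h2 := hpos' s
  have h3 : φ s * (realI s * realI' s) ≤ 0 := mul_nonpos_of_nonpos_of_nonneg hle (by positivity)
  have h4 : φ s * (realI s * realI' s) = realK s * realI' s - 1 := by
    simp only [hφ]; field_simp
  linarith

lemma realK_mul_realI_le {s : ℝ} (hs : 0 ≤ s) : realK s * realI s ≤ 5 / 2 := by
  nlinarith [realI_le_realI' hs, realK_nonneg s, realK_mul_realI'_le s]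

lemma realK_le_of_nonneg {s : ℝ} (hs : 0 ≤ s) : realK s ≤ 5 / 2 := by
  nlinarith [one_le_realI s, realK_nonneg s, realK_mul_realI_le hs]

/-! ### A polynomial bound for the Hankel product -/

lemma norm_half_pi_mul_I_le : ‖(Real.pi : ℂ) / 2 * Complex.I‖ ≤ 2 := by
  rw [norm_mul, Complex.norm_I, mul_one, norm_div, Complex.norm_real, Complex.norm_ofNat,
    Real.norm_of_nonneg Real.pi_pos.le]
  linarith [Real.pi_le_four]

lemma norm_expK_le : ∃ C D : ℝ, 0 ≤ C ∧ 0 ≤ D ∧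
    ∀ u, ‖expK u‖ ≤ C * (1 + ‖u‖) * Real.exp (D * Real.exp u.re) := by
  obtain ⟨C, D, hC, hD, h⟩ := isRapid_coeffI.norm_expSeries_le
  obtain ⟨C', D', hC', hD', h'⟩ := isRapid_coeffB.norm_expSeries_le
  set c : ℝ := ‖(Real.log 2 : ℂ)‖ + ‖(Real.eulerMascheroniConstant : ℂ)‖ with hc
  have hc0 : 0 ≤ c := by positivity
  refine ⟨(1 + c) * C + C', max D D', by positivity, le_max_of_le_left hD, fun u => ?_⟩
  have hL : ‖shiftedLog u‖ ≤ (1 + c) * (1 + ‖u‖) := by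
    have h1 : ‖shiftedLog u‖ ≤ ‖u‖ + c := by
      refine (norm_add_le _ _).trans ?_
      have := norm_sub_le u (Real.log 2 : ℂ)
      linarith
    nlinarith [norm_nonneg u]
  have e1 : Real.exp (D * Real.exp u.re) ≤ Real.exp (max D D' * Real.exp u.re) := by
    gcongr; exact le_max_left _ _
  have e2 : Real.exp (D' * Real.exp u.re) ≤ Real.exp (max D D' * Real.exp u.re) := by
    gcongr; exact le_max_right _ _
  set X := Real.exp (max D D' * Real.exp u.re)
  have hX : 0 < X := Real.exp_pos _
  have hI : ‖expI u‖ ≤ C * X := (h u).trans (by gcongr)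
  have hB : ‖expSeries coeffB u‖ ≤ C' * X := (h' u).trans (by gcongr)
  calc ‖expK u‖ ≤ ‖shiftedLog u‖ * ‖expI u‖ + ‖expSeries coeffB u‖ := by
        refine (norm_add_le _ _).trans ?_
        rw [norm_mul, norm_neg]
    _ ≤ (1 + c) * (1 + ‖u‖) * (C * X) + C' * X * (1 + ‖u‖) := by
        gcongr
        exact hB.trans (le_mul_of_one_le_right (by positivity) (by linarith [norm_nonneg u]))
    _ = _ := by ring

lemma norm_hankelProd_le : ∃ C D : ℝ, 0 ≤ C ∧ 0 ≤ D ∧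
    ∀ u, ‖hankelProd u‖ ≤ C * (1 + ‖u‖) ^ 2 * Real.exp (D * Real.exp u.re) := by
  obtain ⟨C, D, hC, hD, h⟩ := norm_expK_le
  refine ⟨(3 * C) ^ 2, 2 * D, by positivity, by positivity, fun u => ?_⟩
  have key : ∀ v : ℂ, ‖v‖ ≤ ‖u‖ + 2 → v.re = u.re →
      ‖expK v‖ ≤ 3 * C * (1 + ‖u‖) * Real.exp (D * Real.exp u.re) := fun v hv hr => by
    refine (h v).trans ?_
    rw [hr]
    refine mul_le_mul_of_nonneg_right ?_ (Real.exp_pos _).le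
    nlinarith [norm_nonneg u]
  have h1 := key (u - Real.pi / 2 * Complex.I)
    ((norm_sub_le _ _).trans (by linarith [norm_half_pi_mul_I_le])) (by simp)
  have h2 := key (u + Real.pi / 2 * Complex.I)
    ((norm_add_le _ _).trans (by linarith [norm_half_pi_mul_I_le])) (by simp)
  rw [hankelProd, norm_mul]
  refine (mul_le_mul h1 h2 (norm_nonneg _) (by positivity)).trans (le_of_eq ?_)
  rw [show 2 * D * Real.exp u.re = D * Real.exp u.re + D * Real.exp u.re by ring, Real.exp_add]
  ring

/-- Solutions of the Bessel equation `f'' = -e^{2s} f` on the real line are bounded for `s ≥ 0`: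
the energy `|f|² + e^{-2s} |f'|²` is nonincreasing. -/
lemma bounded_of_oscillatory_ode {f f' : ℝ → ℂ} (hf : ∀ s, HasDerivAt f (f' s) s)
    (hf' : ∀ s, HasDerivAt f' ((-(Real.exp (2 * s)) : ℝ) • f s) s) :
    ∃ C, 0 ≤ C ∧ ∀ s, 0 ≤ s → ‖f s‖ ≤ C := by
  set E : ℝ → ℝ := fun s => ‖f s‖ ^ 2 + Real.exp (-2 * s) * ‖f' s‖ ^ 2 with hE
  have hd : ∀ s, HasDerivAt E (-2 * Real.exp (-2 * s) * ‖f' s‖ ^ 2) s := fun s => by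
    have h1 := (hf s).norm_sq
    have h2 := (hf' s).norm_sq
    have h3 : HasDerivAt (fun s : ℝ => Real.exp (-2 * s)) (Real.exp (-2 * s) * (-2 * 1)) s :=
      ((hasDerivAt_id s).const_mul (-2)).exp
    refine (h1.add (h3.mul h2)).congr_deriv ?_
    rw [real_inner_smul_right, real_inner_comm (f s) (f' s)]
    have : Real.exp (-2 * s) * Real.exp (2 * s) = 1 := by rw [← Real.exp_add]; simp
    linear_combination (-2 * inner ℝ (f s) (f' s)) * this
  have hanti : Antitone E := antitone_of_deriv_nonpos (fun s => (hd s).differentiableAt)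
    fun s => by
      rw [(hd s).deriv]
      have : 0 ≤ Real.exp (-2 * s) * ‖f' s‖ ^ 2 := by positivity
      linarith
  refine ⟨Real.sqrt (E 0), Real.sqrt_nonneg _, fun s hs => Real.le_sqrt_of_sq_le ?_⟩
  refine le_trans ?_ (hanti hs)
  simp only [hE]
  have : 0 ≤ Real.exp (-2 * s) * ‖f' s‖ ^ 2 := by positivity
  linarith

lemma exp_two_mul_add_half_pi (u : ℂ) :
    Complex.exp (2 * (u + Real.pi / 2 * Complex.I)) = -Complex.exp (2 * u) := by
  rw [show 2 * (u + Real.pi / 2 * Complex.I) = 2 * u + Real.pi * Complex.I by ring,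
    Complex.exp_add, Complex.exp_pi_mul_I]
  ring

lemma bounded_shift_of_ode {g g' : ℂ → ℂ} (hg : ∀ u, HasDerivAt g (g' u) u)
    (hg' : ∀ u, HasDerivAt g' (Complex.exp (2 * u) * g u) u) :
    ∃ C, 0 ≤ C ∧ ∀ s : ℝ, 0 ≤ s → ‖g (s + Real.pi / 2 * Complex.I)‖ ≤ C := by
  refine bounded_of_oscillatory_ode (f := fun s : ℝ => g (s + Real.pi / 2 * Complex.I))
    (f' := fun s : ℝ => g' (s + Real.pi / 2 * Complex.I))
    (fun s => ((hg _).comp_add_const _ _).comp_ofReal) (fun s => ?_)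
  refine (((hg' _).comp_add_const _ _).comp_ofReal).congr_deriv ?_
  rw [exp_two_mul_add_half_pi, Complex.real_smul]
  push_cast
  rfl

lemma hankelProd_conj (u : ℂ) :
    hankelProd (starRingEnd ℂ u) = starRingEnd ℂ (hankelProd u) := by
  rw [hankelProd, hankelProd, map_mul, ← expK_conj, ← expK_conj, mul_comm]
  congr 2 <;> simp [sub_eq_add_neg, Complex.conj_ofNat]

lemma hankelProd_add_half_pi (u : ℂ) : hankelProd (u + Real.pi / 2 * Complex.I) =
    expK u * (expK u - Real.pi * Complex.I * expI u) := by
  rw [hankelProd, add_sub_cancel_right, show u + Real.pi / 2 * Complex.I + Real.pi / 2 * Complex.I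
    = u + Real.pi * Complex.I by ring, expK_add_pi]

/-- The Hankel product has polynomial growth in `u = log z` on the three rays
`arg z = 0, π/2, π`. -/
lemma norm_hankelProd_le_on_lines : ∃ M : ℝ, 0 ≤ M ∧ ∀ u : ℂ,
    u.im = 0 ∨ u.im = Real.pi / 2 ∨ u.im = Real.pi → ‖hankelProd u‖ ≤ M * (1 + ‖u‖) ^ 2 := by
  obtain ⟨C, D, hC, hD, h⟩ := norm_hankelProd_le
  obtain ⟨A, hA, hJ⟩ := bounded_shift_of_ode hasDerivAt_expI hasDerivAt_expI'
  obtain ⟨B, hB, hK⟩ := bounded_shift_of_ode hasDerivAt_expK hasDerivAt_expK'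
  have hpi : ‖(Real.pi : ℂ) * Complex.I‖ ≤ 4 := by
    rw [norm_mul, Complex.norm_I, mul_one, Complex.norm_real, Real.norm_of_nonneg Real.pi_pos.le]
    exact Real.pi_le_four
  set M := C * Real.exp D + (B + 4 * A) * B + (5 / 2) ^ 2 + 4 * (5 / 2) with hM
  have hM0 : 0 ≤ M := by positivity
  refine ⟨M, hM0, fun u hu => ?_⟩
  rcases le_or_gt u.re 0 with hre | hre
  · refine (h u).trans ?_
    have : Real.exp (D * Real.exp u.re) ≤ Real.exp D := by
      rw [Real.exp_le_exp]
      exact mul_le_of_le_one_right hD (Real.exp_le_one_iff.2 hre)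
    have hle : C * Real.exp D ≤ M := by
      have : 0 ≤ (B + 4 * A) * B := by positivity
      rw [hM]; linarith
    calc C * (1 + ‖u‖) ^ 2 * Real.exp (D * Real.exp u.re)
        ≤ C * (1 + ‖u‖) ^ 2 * Real.exp D := by gcongr
      _ = C * Real.exp D * (1 + ‖u‖) ^ 2 := by ring
      _ ≤ M * (1 + ‖u‖) ^ 2 := by gcongr
  · suffices hQ : ‖hankelProd u‖ ≤ M by
      refine hQ.trans (le_mul_of_one_le_right hM0 ?_)
      have := norm_nonneg u
      nlinarith
    have hCe : 0 ≤ C * Real.exp D := by positivity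
    have hBA : 0 ≤ (B + 4 * A) * B := by positivity
    have hJ' := hJ _ hre.le
    have hK' := hK _ hre.le
    rcases hu with hu | hu | hu
    · have e : u = (u.re : ℂ) := by apply Complex.ext <;> simp [hu]
      rw [e, hankelProd, expK_sub_half_pi, norm_mul]
      have h1 := norm_add_le (expK ((u.re : ℂ) + Real.pi / 2 * Complex.I))
        (Real.pi * Complex.I * expI ((u.re : ℂ) + Real.pi / 2 * Complex.I))
      rw [norm_mul _ (expI _)] at h1
      have h2 := mul_le_mul (h1.trans (add_le_add hK' (mul_le_mul hpi hJ' (norm_nonneg _)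
        (by norm_num)))) hK' (norm_nonneg _) (by positivity)
      refine h2.trans ?_
      rw [hM]; linarith
    · have e : u = (u.re : ℂ) + Real.pi / 2 * Complex.I := by
        apply Complex.ext <;> simp [hu]
      rw [e, hankelProd_add_half_pi, expK_ofReal, expI_ofReal]
      have h1 := realK_nonneg u.re
      have h2 := realK_le_of_nonneg hre.le
      have h3 := realK_mul_realI_le hre.le
      have h4 := one_le_realI u.re
      have h5 : ‖(realK u.re : ℂ) - Real.pi * Complex.I * realI u.re‖ ≤
          realK u.re + 4 * realI u.re := by
        refine (norm_sub_le _ _).trans ?_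
        rw [norm_mul _ (realI u.re : ℂ), Complex.norm_real, Complex.norm_real,
          Real.norm_of_nonneg h1, Real.norm_of_nonneg (by linarith)]
        gcongr
      rw [norm_mul, Complex.norm_real, Real.norm_of_nonneg h1]
      calc _ ≤ realK u.re * (realK u.re + 4 * realI u.re) := by gcongr
        _ = realK u.re ^ 2 + 4 * (realK u.re * realI u.re) := by ring
        _ ≤ (5 / 2) ^ 2 + 4 * (5 / 2) := by gcongr
        _ ≤ M := by rw [hM]; linarith
    · have e : u = ((u.re : ℂ) + Real.pi / 2 * Complex.I) + Real.pi / 2 * Complex.I := by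
        apply Complex.ext
        · simp
        · simp [hu]
      rw [e, hankelProd_add_half_pi, norm_mul]
      have h1 := norm_sub_le (expK ((u.re : ℂ) + Real.pi / 2 * Complex.I))
        (Real.pi * Complex.I * expI ((u.re : ℂ) + Real.pi / 2 * Complex.I))
      rw [norm_mul _ (expI _)] at h1
      have h2 := mul_le_mul hK' (h1.trans (add_le_add hK' (mul_le_mul hpi hJ' (norm_nonneg _)
        (by norm_num)))) (norm_nonneg _) hB
      refine h2.trans ?_
      rw [hM]; linarith

lemma differentiable_expK : Differentiable ℂ expK := fun u => (hasDerivAt_expK u).differentiableAt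

lemma differentiable_hankelProd : Differentiable ℂ hankelProd :=
  (differentiable_expK.comp (differentiable_id.sub_const _)).mul
    (differentiable_expK.comp (differentiable_id.add_const _))

lemma norm_add_I_bounds {u : ℂ} (hu : 0 ≤ u.im) :
    1 ≤ ‖u + Complex.I‖ ∧ 1 + ‖u‖ ≤ 3 * ‖u + Complex.I‖ := by
  have h1 : 1 ≤ ‖u + Complex.I‖ := by
    have := (le_abs_self _).trans (Complex.abs_im_le_norm (u + Complex.I))
    simp only [Complex.add_im, Complex.I_im] at this
    linarith
  refine ⟨h1, ?_⟩
  have : ‖u‖ ≤ ‖u + Complex.I‖ + 1 := by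
    simpa using norm_sub_le (u + Complex.I) Complex.I
  linarith

lemma norm_hankelProd_le_of_strip {M a b : ℝ} (hM : 0 ≤ M) (ha : 0 ≤ a)
    (hab : b - a = Real.pi / 2) (hb : b ≤ Real.pi)
    (h : ∀ u : ℂ, u.im = a ∨ u.im = b → ‖hankelProd u‖ ≤ M * (1 + ‖u‖) ^ 2)
    {u : ℂ} (hua : a ≤ u.im) (hub : u.im ≤ b) :
    ‖hankelProd u‖ ≤ 9 * M * (1 + ‖u‖) ^ 2 := by
  have hne : ∀ v : ℂ, 0 ≤ v.im → v + Complex.I ≠ 0 := fun v hv h0 => by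
    have := (norm_add_I_bounds hv).1
    rw [h0, norm_zero] at this
    linarith
  have hπ := Real.pi_pos
  set f : ℂ → ℂ := fun v => hankelProd v / (v + Complex.I) ^ 2 with hf
  have hdiff : ∀ v : ℂ, 0 ≤ v.im → DifferentiableAt ℂ f v := fun v hv =>
    (differentiable_hankelProd v).div ((differentiableAt_id.add_const _).pow 2)
      (pow_ne_zero 2 (hne v hv))
  have hedge : ∀ v : ℂ, v.im = a ∨ v.im = b → ‖f v‖ ≤ 9 * M := fun v hv => by
    have hv0 : 0 ≤ v.im := by rcases hv with hv | hv <;> rw [hv] <;> linarith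
    obtain ⟨h1, h2⟩ := norm_add_I_bounds hv0
    simp only [hf]
    rw [norm_div, norm_pow, div_le_iff₀ (by positivity)]
    refine (h v hv).trans ?_
    calc M * (1 + ‖v‖) ^ 2 ≤ M * (3 * ‖v + Complex.I‖) ^ 2 := by gcongr
      _ = _ := by ring
  have hPL : ‖f u‖ ≤ 9 * M := by
    refine PhragmenLindelof.horizontal_strip (a := a) (b := b) ?_ ?_ (fun v hv => hedge v (.inl hv))
      (fun v hv => hedge v (.inr hv)) hua hub
    · have hd : DifferentiableOn ℂ f {v : ℂ | 0 ≤ v.im} := fun v hv =>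
        (hdiff v hv).differentiableWithinAt
      refine (hd.mono ?_).diffContOnCl
      refine closure_minimal ?_ (isClosed_le continuous_const Complex.continuous_im)
      intro v hv
      exact ha.trans hv.1.le
    · obtain ⟨C, D, hC, hD, hQ⟩ := norm_hankelProd_le
      refine ⟨1, ?_, 2 + D, ?_⟩
      · rw [hab, lt_div_iff₀ (by positivity)]; linarith
      refine Asymptotics.IsBigO.of_bound (25 * C) ?_
      filter_upwards [mem_inf_of_right (mem_principal_self _)] with v hv
      have hv0 : 0 ≤ v.im := ha.trans hv.1.le
      obtain ⟨h1, -⟩ := norm_add_I_bounds hv0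
      have hnorm : 1 + ‖v‖ ≤ 5 * Real.exp |v.re| := by
        have h2 := Complex.norm_le_abs_re_add_abs_im v
        have h3 : |v.im| ≤ 4 := by
          rw [abs_of_nonneg hv0]; linarith [hv.2, Real.pi_le_four]
        have h4 := Real.add_one_le_exp |v.re|
        have := abs_nonneg v.re
        linarith
      have hsq : Real.exp |v.re| ^ 2 ≤ Real.exp (2 * Real.exp |v.re|) := by
        rw [← Real.exp_nat_mul, Real.exp_le_exp]
        have h4 := Real.add_one_le_exp |v.re|
        push_cast
        linarith
      have hD' : Real.exp (D * Real.exp v.re) ≤ Real.exp (D * Real.exp |v.re|) := by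
        gcongr; exact le_abs_self _
      rw [Real.norm_of_nonneg (Real.exp_pos _).le, one_mul]
      simp only [hf]
      rw [norm_div, norm_pow]
      calc ‖hankelProd v‖ / ‖v + Complex.I‖ ^ 2 ≤ ‖hankelProd v‖ :=
            div_le_self (norm_nonneg _) (one_le_pow₀ h1)
        _ ≤ C * (1 + ‖v‖) ^ 2 * Real.exp (D * Real.exp v.re) := hQ v
        _ ≤ C * (5 * Real.exp |v.re|) ^ 2 * Real.exp (D * Real.exp |v.re|) := by gcongr
        _ = 25 * C * (Real.exp |v.re| ^ 2 * Real.exp (D * Real.exp |v.re|)) := by ring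
        _ ≤ 25 * C * (Real.exp (2 * Real.exp |v.re|) * Real.exp (D * Real.exp |v.re|)) := by gcongr
        _ = 25 * C * Real.exp ((2 + D) * Real.exp |v.re|) := by rw [← Real.exp_add]; ring_nf
  have hu0 : 0 ≤ u.im := ha.trans hua
  obtain ⟨h1, -⟩ := norm_add_I_bounds hu0
  simp only [hf] at hPL
  rw [norm_div, norm_pow, div_le_iff₀ (by positivity)] at hPL
  refine hPL.trans ?_
  have : ‖u + Complex.I‖ ≤ 1 + ‖u‖ := (norm_add_le _ _).trans (by simp [add_comm])
  gcongr

/-- The Phragmén–Lindelöf principle in the quadrants extends the bound to `|arg z| ≤ π`. -/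
lemma norm_hankelProd_le_sq : ∃ M : ℝ, 0 ≤ M ∧ ∀ u : ℂ, |u.im| ≤ Real.pi →
    ‖hankelProd u‖ ≤ M * (1 + ‖u‖) ^ 2 := by
  obtain ⟨M, hM, h⟩ := norm_hankelProd_le_on_lines
  have hπ := Real.pi_pos
  have hup : ∀ u : ℂ, 0 ≤ u.im → u.im ≤ Real.pi →
      ‖hankelProd u‖ ≤ 9 * M * (1 + ‖u‖) ^ 2 := fun u h0 h1 => by
    rcases le_total u.im (Real.pi / 2) with h2 | h2
    · refine norm_hankelProd_le_of_strip hM le_rfl (by ring) (by linarith) (fun v hv => h v ?_) h0 h2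
      tauto
    · refine norm_hankelProd_le_of_strip hM (by positivity) (by ring) le_rfl (fun v hv => h v ?_)
        h2 h1
      tauto
  refine ⟨9 * M, by positivity, fun u hu => ?_⟩
  obtain ⟨h1, h2⟩ := abs_le.1 hu
  rcases le_total 0 u.im with h0 | h0
  · exact hup u h0 h2
  · have := hup (starRingEnd ℂ u) (by simpa using h0) (by simp; linarith)
    rwa [hankelProd_conj, Complex.norm_conj, Complex.norm_conj] at this

/-! ### Asymptotics in horizontal half-strips -/

/-- The filter `re u → ∞` in the strip `|im u| ≤ β`; in the variable `z = e^u` this is `|z| → ∞`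
in the sector `|arg z| ≤ β`. -/
def stripAtTop (β : ℝ) : Filter ℂ := comap Complex.re atTop ⊓ 𝓟 {u : ℂ | |u.im| ≤ β}

/-- The comparison function `|z|^{-a}` in the variable `u = log z`. -/
noncomputable def decay (a : ℝ) (u : ℂ) : ℝ := Real.exp (-a * u.re)

lemma decay_pos (a : ℝ) (u : ℂ) : 0 < decay a u := Real.exp_pos _

lemma norm_decay (a : ℝ) (u : ℂ) : ‖decay a u‖ = decay a u := Real.norm_of_nonneg (decay_pos a u).le

lemma decay_mul (a b : ℝ) (u : ℂ) : decay a u * decay b u = decay (a + b) u := by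
  rw [decay, decay, decay, ← Real.exp_add]; ring_nf

lemma eventually_stripAtTop {β : ℝ} {P : ℂ → Prop} :
    (∀ᶠ u in stripAtTop β, P u) ↔ ∃ r : ℝ, ∀ u : ℂ, r ≤ u.re → |u.im| ≤ β → P u := by
  rw [stripAtTop, eventually_inf_principal, eventually_comap, eventually_atTop]
  constructor
  · rintro ⟨r, h⟩
    exact ⟨r, fun u hu hb => h _ hu u rfl hb⟩
  · rintro ⟨r, h⟩
    exact ⟨r, fun b hb u hu hi => h u (hu ▸ hb) hi⟩

lemma stripAtTop_mono {β β' : ℝ} (h : β' ≤ β) : stripAtTop β' ≤ stripAtTop β :=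
  inf_le_inf_left _ (principal_mono.2 fun _ hu => le_trans hu h)

lemma isBigO_decay_iff {β a : ℝ} {G : ℂ → ℂ} : G =O[stripAtTop β] decay a ↔
    ∃ C r : ℝ, 0 ≤ C ∧ ∀ u : ℂ, r ≤ u.re → |u.im| ≤ β → ‖G u‖ ≤ C * decay a u := by
  rw [Asymptotics.isBigO_iff']
  simp_rw [eventually_stripAtTop, norm_decay]
  constructor
  · rintro ⟨C, hC, r, h⟩
    exact ⟨C, r, hC.le, h⟩
  · rintro ⟨C, r, hC, h⟩
    refine ⟨C + 1, by positivity, r, fun u h1 h2 => (h u h1 h2).trans ?_⟩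
    have := decay_pos a u
    gcongr
    linarith

lemma tendsto_ofReal_stripAtTop {β : ℝ} (hβ : 0 ≤ β) :
    Tendsto (fun s : ℝ => (s : ℂ)) atTop (stripAtTop β) := by
  rw [stripAtTop, tendsto_inf, tendsto_comap_iff, tendsto_principal]
  exact ⟨tendsto_id, Eventually.of_forall fun s => by simpa using hβ⟩

lemma tendsto_re_stripAtTop (β : ℝ) : Tendsto Complex.re (stripAtTop β) atTop :=
  tendsto_comap.mono_left inf_le_left

lemma decay_isBigO_decay {β a b : ℝ} (h : b ≤ a) : decay a =O[stripAtTop β] decay b := by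
  refine Asymptotics.IsBigO.of_bound 1 (eventually_stripAtTop.2 ⟨0, fun u hu _ => ?_⟩)
  rw [norm_decay, norm_decay, one_mul, decay, decay, Real.exp_le_exp]
  nlinarith

lemma tendsto_decay_zero {β a : ℝ} (ha : 0 < a) : Tendsto (decay a) (stripAtTop β) (𝓝 0) :=
  Real.tendsto_exp_atBot.comp
    ((tendsto_re_stripAtTop β).const_mul_atTop_of_neg (by linarith))

lemma tendsto_zero_of_isBigO_decay {β a : ℝ} (hβ : 0 ≤ β) (ha : 0 < a) {G : ℂ → ℂ}
    (h : G =O[stripAtTop β] decay a) : Tendsto (fun s : ℝ => G s) atTop (𝓝 0) :=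
  (h.trans_tendsto (tendsto_decay_zero ha)).comp (tendsto_ofReal_stripAtTop hβ)

lemma cexp_isBigO_decay {β : ℝ} (a : ℝ) :
    (fun u : ℂ => Complex.exp (-(a : ℂ) * u)) =O[stripAtTop β] decay a := by
  refine Asymptotics.IsBigO.of_bound 1 (Eventually.of_forall fun u => ?_)
  rw [norm_decay, one_mul, Complex.norm_exp, decay]
  simp

lemma isBigO_decay_mul {β a b : ℝ} {G H : ℂ → ℂ} (hG : G =O[stripAtTop β] decay a)
    (hH : H =O[stripAtTop β] decay b) :
    (fun u => G u * H u) =O[stripAtTop β] decay (a + b) := by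
  refine (hG.mul hH).congr_right fun u => decay_mul a b u

/-- Cauchy's estimate: a bound by `|z|^{-a}` in a strip holds for the derivative in any narrower
strip. -/
lemma deriv_isBigO_decay {G : ℂ → ℂ} (hG : Differentiable ℂ G) {a β β' : ℝ} (hβ : β' < β)
    (h : G =O[stripAtTop β] decay a) : deriv G =O[stripAtTop β'] decay a := by
  obtain ⟨C, r, hC, h⟩ := isBigO_decay_iff.1 h
  set ρ := β - β' with hρ
  have hρ0 : 0 < ρ := by linarith
  refine isBigO_decay_iff.2 ⟨C * Real.exp (|a| * ρ) / ρ, r + ρ, by positivity, fun u hu hi => ?_⟩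
  have key : ∀ v ∈ Metric.sphere u ρ, ‖G v‖ ≤ C * Real.exp (|a| * ρ) * decay a u := fun v hv => by
    have hd : ‖v - u‖ = ρ := by rwa [mem_sphere_iff_norm] at hv
    have h1 := (Complex.abs_re_le_norm (v - u)).trans hd.le
    have h2 := (Complex.abs_im_le_norm (v - u)).trans hd.le
    rw [Complex.sub_re] at h1
    rw [Complex.sub_im] at h2
    have h3 : |v.im| ≤ β := by
      have := abs_sub_abs_le_abs_sub v.im u.im
      linarith
    refine (h v (by linarith [(abs_le.1 h1).1]) h3).trans ?_
    rw [mul_assoc]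
    refine mul_le_mul_of_nonneg_left ?_ hC
    rw [decay, decay, ← Real.exp_add, Real.exp_le_exp]
    have h4 : a * (u.re - v.re) ≤ |a| * ρ := by
      refine (le_abs_self _).trans ?_
      rw [abs_mul, abs_sub_comm]
      gcongr
    linarith
  refine (Complex.norm_deriv_le_of_forall_mem_sphere_norm_le hρ0 hG.diffContOnCl key).trans
    (le_of_eq (by ring))

/-- Integration of asymptotic bounds: if `G' = O(|z|^{-a})` with `a > 0`, then `G` tends to
a constant with the same rate. -/
lemma exists_const_of_deriv_isBigO_decay {G : ℂ → ℂ} (hG : Differentiable ℂ G) {a β : ℝ}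
    (ha : 0 < a) (h : deriv G =O[stripAtTop β] decay a) (hβ : 0 ≤ β) :
    ∃ c : ℂ, (fun u => G u - c) =O[stripAtTop β] decay a := by
  obtain ⟨C, r, hC, h⟩ := isBigO_decay_iff.1 h
  -- Along the real line the increments of `G` are controlled by a primitive of the bound.
  have hor : ∀ x y : ℝ, r ≤ x → x ≤ y → ‖G y - G x‖ ≤ C / a * Real.exp (-a * x) := by
    intro x y hx hxy
    have hd : ∀ t : ℝ, HasDerivAt (fun t : ℝ => G t - G x) (deriv G t) t := fun t =>
      ((hG t).hasDerivAt.comp_ofReal).sub_const _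
    have hB : ∀ t : ℝ, HasDerivAt (fun t : ℝ => C / a * (Real.exp (-a * x) - Real.exp (-a * t)))
        (C * Real.exp (-a * t)) t := fun t => by
      have h1 : HasDerivAt (fun t : ℝ => Real.exp (-a * t)) (Real.exp (-a * t) * (-a * 1)) t :=
        ((hasDerivAt_id t).const_mul (-a)).exp
      refine ((h1.const_sub (Real.exp (-a * x))).const_mul (C / a)).congr_deriv ?_
      field_simp
    have := image_norm_le_of_norm_deriv_right_le_deriv_boundary (a := x) (b := y)
      (fun t _ => (hd t).continuousAt.continuousWithinAt)
      (fun t _ => (hd t).hasDerivWithinAt) (by simp) hB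
      (fun t ht => by
        have := h (t : ℂ) (by simpa using hx.trans ht.1) (by simpa using hβ)
        simpa [decay] using this)
      ⟨hxy, le_rfl⟩
    refine this.trans ?_
    gcongr
    linarith [Real.exp_pos (-a * y)]
  have hlim0 : Tendsto (fun x : ℝ => C / a * Real.exp (-a * x)) atTop (𝓝 0) := by
    have := (Real.tendsto_exp_atBot.comp
      (tendsto_id.const_mul_atTop_of_neg (show -a < 0 by linarith))).const_mul (C / a)
    simpa using this
  obtain ⟨c, hc⟩ : ∃ c, Tendsto (fun x : ℝ => G x) atTop (𝓝 c) := by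
    refine cauchySeq_tendsto_of_complete (Metric.cauchySeq_iff'.2 fun ε hε => ?_)
    obtain ⟨N, hN⟩ := ((hlim0.eventually (gt_mem_nhds hε)).and (eventually_ge_atTop r)).exists
    exact ⟨N, fun n hn => by rw [dist_eq_norm]; exact (hor N n hN.2 hn).trans_lt hN.1⟩
  refine ⟨c, isBigO_decay_iff.2 ⟨C / a + C * β, r, by positivity, fun u hu hi => ?_⟩⟩
  have h1 : ‖G u.re - c‖ ≤ C / a * decay a u := by
    have := le_of_tendsto (((hc.sub_const (G u.re)).norm))
      (eventually_atTop.2 ⟨u.re, fun y hy => hor u.re y hu hy⟩)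
    rwa [norm_sub_rev, ← decay] at this
  have h2 : ‖G u - G u.re‖ ≤ C * decay a u * ‖u - u.re‖ := by
    have hconv : Convex ℝ {v : ℂ | u.re ≤ v.re ∧ -β ≤ v.im ∧ v.im ≤ β} :=
      (convex_halfSpace_re_ge _).inter ((convex_halfSpace_im_ge _).inter (convex_halfSpace_im_le _))
    refine hconv.norm_image_sub_le_of_norm_deriv_le (fun v _ => hG v) (fun v hv => ?_)
      ⟨by simp, by simpa using hβ, by simpa using hβ⟩ ⟨le_rfl, abs_le.1 hi⟩
    refine (h v (hu.trans hv.1) (abs_le.2 hv.2)).trans ?_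
    refine mul_le_mul_of_nonneg_left ?_ hC
    rw [decay, decay, Real.exp_le_exp]
    nlinarith [hv.1]
  have h3 : ‖u - u.re‖ ≤ β := by
    have : u - u.re = u.im * Complex.I := by
      apply Complex.ext <;> simp
    rw [this, norm_mul, Complex.norm_I, mul_one, Complex.norm_real]
    exact hi
  have h4 := decay_pos a u
  calc ‖G u - c‖ = ‖(G u - G u.re) + (G u.re - c)‖ := by ring_nf
    _ ≤ C * decay a u * β + C / a * decay a u :=
        (norm_add_le _ _).trans (add_le_add (h2.trans (by gcongr)) h1)
    _ = _ := by ring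

/-! ### The asymptotic expansion of the Hankel product -/

/-- The first derivative of `hankelProd`. -/
noncomputable def hankelProd' (u : ℂ) : ℂ :=
  expK' (u - Real.pi / 2 * Complex.I) * expK (u + Real.pi / 2 * Complex.I) +
    expK (u - Real.pi / 2 * Complex.I) * expK' (u + Real.pi / 2 * Complex.I)

/-- The second derivative of `hankelProd`. -/
noncomputable def hankelProd'' (u : ℂ) : ℂ :=
  -2 * Complex.exp (2 * u) * hankelProd u +
    2 * (expK' (u - Real.pi / 2 * Complex.I) * expK' (u + Real.pi / 2 * Complex.I))

lemma exp_two_mul_sub_half_pi (u : ℂ) :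
    Complex.exp (2 * (u - Real.pi / 2 * Complex.I)) = -Complex.exp (2 * u) := by
  rw [← neg_eq_iff_eq_neg, ← exp_two_mul_add_half_pi, sub_add_cancel]

lemma hasDerivAt_hankelProd (u : ℂ) : HasDerivAt hankelProd (hankelProd' u) u :=
  ((hasDerivAt_expK _).comp_sub_const _ _).mul ((hasDerivAt_expK _).comp_add_const _ _)

lemma hasDerivAt_hankelProd' (u : ℂ) : HasDerivAt hankelProd' (hankelProd'' u) u := by
  refine ((((hasDerivAt_expK' _).comp_sub_const _ _).mul
    ((hasDerivAt_expK _).comp_add_const u _)).add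
    (((hasDerivAt_expK _).comp_sub_const u _).mul
    ((hasDerivAt_expK' _).comp_add_const u _))).congr_deriv ?_
  rw [exp_two_mul_add_half_pi, exp_two_mul_sub_half_pi, hankelProd'', hankelProd]
  ring

/-- The third-order equation of the product of two solutions of `f'' = -e^{2u} f`. -/
lemma hasDerivAt_hankelProd'' (u : ℂ) : HasDerivAt hankelProd''
    (-4 * Complex.exp (2 * u) * (hankelProd u + hankelProd' u)) u := by
  have hexp : HasDerivAt (fun u : ℂ => -2 * Complex.exp (2 * u))
      (-2 * (Complex.exp (2 * u) * (2 * 1))) u :=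
    ((hasDerivAt_id u).const_mul (2 : ℂ)).cexp.const_mul (-2)
  refine ((hexp.mul (hasDerivAt_hankelProd u)).add
    ((((hasDerivAt_expK' _).comp_sub_const _ _).mul
    ((hasDerivAt_expK' _).comp_add_const u _)).const_mul 2)).congr_deriv ?_
  rw [exp_two_mul_add_half_pi, exp_two_mul_sub_half_pi, hankelProd', hankelProd]
  ring

/-- The square of the Wronskian of the two Hankel functions, a first integral of the third-order
equation. -/
lemma hankelProd_first_integral (u : ℂ) : hankelProd' u ^ 2 - 2 * hankelProd u * hankelProd'' u
    - 4 * Complex.exp (2 * u) * hankelProd u ^ 2 = -(Real.pi : ℂ) ^ 2 := by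
  have hw := expI_wronskian (u + Real.pi / 2 * Complex.I)
  have h1 := expK'_add_pi (u - Real.pi / 2 * Complex.I)
  have h2 := expI'_add_pi (u - Real.pi / 2 * Complex.I)
  rw [show u - Real.pi / 2 * Complex.I + Real.pi * Complex.I = u + Real.pi / 2 * Complex.I by
    ring] at h1 h2
  have h3 : expK' (u - Real.pi / 2 * Complex.I) = expK' (u + Real.pi / 2 * Complex.I) +
      Real.pi * Complex.I * expI' (u + Real.pi / 2 * Complex.I) := by rw [h1, h2]; ring
  rw [hankelProd'', hankelProd', hankelProd, h3, expK_sub_half_pi]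
  set g := expK (u + Real.pi / 2 * Complex.I)
  set g' := expK' (u + Real.pi / 2 * Complex.I)
  set j := expI (u + Real.pi / 2 * Complex.I)
  set j' := expI' (u + Real.pi / 2 * Complex.I)
  linear_combination (Real.pi : ℂ) ^ 2 * (j * g' - j' * g) ^ 2 * Complex.I_sq -
    (Real.pi : ℂ) ^ 2 * (j * g' - j' * g - 1) * hw

/-- `(π z / 2) H_0^{(1)}(z) H_0^{(2)}(z)` for `z = e^u`, normalized so as to tend to `1`. -/
noncomputable def hankelNormal (u : ℂ) : ℂ := 2 / Real.pi * (Complex.exp u * hankelProd u)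

lemma differentiable_hankelNormal : Differentiable ℂ hankelNormal :=
  ((Complex.differentiable_exp.mul differentiable_hankelProd)).const_mul _

lemma deriv_hankelNormal : deriv hankelNormal =
    fun u => 2 / Real.pi * (Complex.exp u * (hankelProd u + hankelProd' u)) := by
  funext u
  have := (((Complex.hasDerivAt_exp u).mul (hasDerivAt_hankelProd u)).const_mul
    (2 / Real.pi : ℂ)).deriv
  refine Eq.trans this ?_
  ring

lemma deriv2_hankelNormal : deriv (deriv hankelNormal) = fun u =>
    2 / Real.pi * (Complex.exp u * (hankelProd u + 2 * hankelProd' u + hankelProd'' u)) := by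
  funext u
  rw [deriv_hankelNormal]
  have := (((Complex.hasDerivAt_exp u).mul ((hasDerivAt_hankelProd u).add
    (hasDerivAt_hankelProd' u))).const_mul (2 / Real.pi : ℂ)).deriv
  refine Eq.trans this ?_
  simp only [Pi.add_apply]
  ring

lemma hankelNormal_ode (u : ℂ) : deriv hankelNormal u = -(1 / 4) * (Complex.exp (-(2 : ℝ) * u) *
    (deriv (deriv (deriv hankelNormal)) u - 3 * deriv (deriv hankelNormal) u
      + 3 * deriv hankelNormal u - hankelNormal u)) := by
  have h3 : deriv (deriv (deriv hankelNormal)) u = 2 / Real.pi * (Complex.exp u *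
      (hankelProd u + 2 * hankelProd' u + hankelProd'' u) + Complex.exp u *
      (hankelProd' u + 2 * hankelProd'' u +
        (-4 * Complex.exp (2 * u) * (hankelProd u + hankelProd' u)))) := by
    rw [deriv2_hankelNormal]
    exact (((Complex.hasDerivAt_exp u).mul (((hasDerivAt_hankelProd u).add
      ((hasDerivAt_hankelProd' u).const_mul 2)).add (hasDerivAt_hankelProd'' u))).const_mul
      (2 / Real.pi : ℂ)).deriv
  have hexp : Complex.exp (-(2 : ℝ) * u) * Complex.exp (2 * u) = 1 := by
    rw [← Complex.exp_add]; simp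
  rw [h3, deriv2_hankelNormal, deriv_hankelNormal, hankelNormal]
  linear_combination (-(2 / Real.pi * (Complex.exp u * (hankelProd u + hankelProd' u)))) * hexp

lemma hankelNormal_first_integral (u : ℂ) :
    Complex.exp (-(2 : ℝ) * u) * ((deriv hankelNormal u - hankelNormal u) ^ 2 -
      2 * hankelNormal u * (deriv (deriv hankelNormal) u - 2 * deriv hankelNormal u
        + hankelNormal u)) - 4 * hankelNormal u ^ 2 = -4 := by
  have hpi : (Real.pi : ℂ) ≠ 0 := by exact_mod_cast Real.pi_ne_zero
  have h := hankelProd_first_integral u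
  have hexp : Complex.exp (-(2 : ℝ) * u) * Complex.exp u ^ 2 = 1 := by
    rw [← Complex.exp_nat_mul, ← Complex.exp_add]; simp
  have hsq : Complex.exp (2 * u) = Complex.exp u ^ 2 := by
    rw [← Complex.exp_nat_mul]; norm_num
  rw [hsq] at h
  rw [deriv2_hankelNormal, deriv_hankelNormal, hankelNormal]
  have e : (2 / Real.pi : ℂ) ^ 2 * (Real.pi : ℂ) ^ 2 = 4 := by field_simp; norm_num
  linear_combination (2 / Real.pi : ℂ) ^ 2 * h - e + (2 / Real.pi : ℂ) ^ 2 *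
    (hankelProd' u ^ 2 - 2 * hankelProd u * hankelProd'' u) * hexp

lemma differentiable_deriv {G : ℂ → ℂ} (hG : Differentiable ℂ G) : Differentiable ℂ (deriv G) :=
  fun u => (hG.analyticAt u).deriv.differentiableAt

/-- Cauchy's estimate for the operator `(D - 1)³`. -/
lemma isBigO_decay_cubic {G : ℂ → ℂ} (hG : Differentiable ℂ G) {a β β' : ℝ} (hβ : β' < β)
    (h : G =O[stripAtTop β] decay a) :
    (fun u => deriv (deriv (deriv G)) u - 3 * deriv (deriv G) u + 3 * deriv G u - G u)
      =O[stripAtTop β'] decay a := by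
  have h1 := deriv_isBigO_decay hG (show β' + 2 * (β - β') / 3 < β by linarith) h
  have h2 := deriv_isBigO_decay (differentiable_deriv hG)
    (show β' + (β - β') / 3 < β' + 2 * (β - β') / 3 by linarith) h1
  have h3 := deriv_isBigO_decay (differentiable_deriv (differentiable_deriv hG))
    (show β' < β' + (β - β') / 3 by linarith) h2
  have h1' := h1.mono (stripAtTop_mono (show β' ≤ β' + 2 * (β - β') / 3 by linarith))
  have h2' := h2.mono (stripAtTop_mono (show β' ≤ β' + (β - β') / 3 by linarith))
  have h0' := h.mono (stripAtTop_mono hβ.le)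
  exact ((h3.sub (h2'.const_mul_left 3)).add (h1'.const_mul_left 3)).sub h0'

lemma hankelNormal_isBigO_growth : hankelNormal =O[stripAtTop Real.pi] decay (-(3 / 2)) := by
  obtain ⟨M, hM, h⟩ := norm_hankelProd_le_sq
  refine isBigO_decay_iff.2 ⟨‖(2 / Real.pi : ℂ)‖ * (M * 400), 0, by positivity, fun u hu hi => ?_⟩
  have h1 : (1 + ‖u‖) ^ 2 ≤ 400 * Real.exp (u.re / 2) := by
    have h2 := Complex.norm_le_abs_re_add_abs_im u
    rw [abs_of_nonneg hu] at h2
    have h3 := Real.add_one_le_exp (u.re / 4)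
    have h4 : 1 + ‖u‖ ≤ 20 * Real.exp (u.re / 4) := by linarith [Real.pi_le_four]
    calc (1 + ‖u‖) ^ 2 ≤ (20 * Real.exp (u.re / 4)) ^ 2 := by gcongr
      _ = 400 * Real.exp (u.re / 2) := by
          rw [mul_pow, ← Real.exp_nat_mul]; norm_num; ring
  rw [hankelNormal, norm_mul, norm_mul, Complex.norm_exp, mul_assoc]
  refine mul_le_mul_of_nonneg_left ?_ (norm_nonneg _)
  calc Real.exp u.re * ‖hankelProd u‖ ≤ Real.exp u.re * (M * (400 * Real.exp (u.re / 2))) := by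
        gcongr; exact (h u hi).trans (by gcongr)
    _ = M * 400 * (Real.exp u.re * Real.exp (u.re / 2)) := by ring
    _ = _ := by rw [← Real.exp_add, decay]; ring_nf

lemma hankelNormal_ofReal_nonneg (s : ℝ) : ∃ x : ℝ, 0 ≤ x ∧ hankelNormal s = x := by
  refine ⟨2 / Real.pi * (Real.exp s * Complex.normSq (expK (s + Real.pi / 2 * Complex.I))),
    mul_nonneg (by positivity) (mul_nonneg (Real.exp_pos _).le (Complex.normSq_nonneg _)), ?_⟩
  have e : (s : ℂ) - Real.pi / 2 * Complex.I =
      starRingEnd ℂ ((s : ℂ) + Real.pi / 2 * Complex.I) := by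
    simp [sub_eq_add_neg, Complex.conj_ofNat]
  rw [hankelNormal, hankelProd, e, expK_conj, ← Complex.normSq_eq_conj_mul_self]
  push_cast
  rfl

/-- The leading term: integrating the third-order equation gives a limit `c`, the first integral
gives `c² = 1`, and `c ≥ 0` since the two Hankel functions are conjugate on the positive
half-line. -/
lemma hankelNormal_leading {β : ℝ} (hβ0 : 0 ≤ β) (hβ : β < Real.pi) :
    (fun u => hankelNormal u - 1) =O[stripAtTop β] decay (1 / 2) := by
  have hd := differentiable_hankelNormal
  have hd1 : ∀ β < Real.pi, deriv hankelNormal =O[stripAtTop β] decay (1 / 2) := fun β hβ => by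
    have h := ((isBigO_decay_mul (cexp_isBigO_decay 2)
      (isBigO_decay_cubic hd hβ hankelNormal_isBigO_growth)).const_mul_left (-(1 / 4)))
    rw [show (2 : ℝ) + -(3 / 2) = 1 / 2 by norm_num] at h
    exact h.congr_left fun u => (hankelNormal_ode u).symm
  obtain ⟨c, hc⟩ := exists_const_of_deriv_isBigO_decay hd (by norm_num) (hd1 β hβ) hβ0
  suffices c = 1 by rwa [this] at hc
  have hhalf : (0 : ℝ) < 1 / 2 := by norm_num
  have l0 : Tendsto (fun s : ℝ => hankelNormal s) atTop (𝓝 c) := by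
    simpa using (tendsto_zero_of_isBigO_decay hβ0 hhalf hc).add_const c
  have l1 := tendsto_zero_of_isBigO_decay hβ0 hhalf (hd1 β hβ)
  have l2 := tendsto_zero_of_isBigO_decay hβ0 hhalf
    (deriv_isBigO_decay (differentiable_deriv hd) (show β < (β + Real.pi) / 2 by linarith)
      (hd1 _ (by linarith)))
  have lx := tendsto_zero_of_isBigO_decay (β := 0) le_rfl two_pos (cexp_isBigO_decay 2)
  have hlim := (lx.mul (((l1.sub l0).pow 2).sub ((l0.const_mul 2).mul
    ((l2.sub (l1.const_mul 2)).add l0)))).sub ((l0.pow 2).const_mul 4)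
  simp_rw [hankelNormal_first_integral] at hlim
  have hc2 : c ^ 2 = 1 := by
    have := tendsto_nhds_unique hlim tendsto_const_nhds
    linear_combination -(1 / 4 : ℂ) * this
  choose x hx0 hx using hankelNormal_ofReal_nonneg
  have hcre : 0 ≤ c.re := by
    refine ge_of_tendsto ((Complex.continuous_re.tendsto c).comp l0)
      (Eventually.of_forall fun s => ?_)
    simp only [Function.comp_apply, hx, Complex.ofReal_re, hx0]
  have hfac : (c - 1) * (c + 1) = 0 := by linear_combination hc2
  rcases mul_eq_zero.1 hfac with h | h
  · exact sub_eq_zero.1 h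
  · rw [eq_neg_of_add_eq_zero_left h] at hcre; norm_num at hcre

/-- The coefficients of the expansion of `(π z / 2) H_0^{(1)}(z) H_0^{(2)}(z)` in powers of
`z^{-2}`. -/
def hankelCoeff : ℕ → ℚ
  | 0 => 1
  | k + 1 => -(2 * k + 1) ^ 3 / (8 * (k + 1)) * hankelCoeff k

/-- Finite sums `∑ c_k z^{-2k}` in the variable `u = log z`. -/
noncomputable def inversePowerSum (c : ℕ → ℂ) (K : ℕ) (u : ℂ) : ℂ :=
  ∑ k ∈ Finset.range K, c k * Complex.exp (-(2 : ℝ) * u) ^ k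

lemma hasDerivAt_inversePowerSum (c : ℕ → ℂ) (K : ℕ) (u : ℂ) :
    HasDerivAt (inversePowerSum c K) (inversePowerSum (fun k => -2 * k * c k) K u) u := by
  refine HasDerivAt.fun_sum fun k _ => ?_
  have h : HasDerivAt (fun u : ℂ => Complex.exp (-(2 : ℝ) * u))
      (Complex.exp (-(2 : ℝ) * u) * (-(2 : ℝ) * 1)) u :=
    ((hasDerivAt_id u).const_mul (-((2 : ℝ) : ℂ))).cexp
  refine ((h.pow k).const_mul (c k)).congr_deriv ?_
  rcases k with _ | k
  · simp
  · push_cast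
    ring

lemma deriv_inversePowerSum (c : ℕ → ℂ) (K : ℕ) :
    deriv (inversePowerSum c K) = inversePowerSum (fun k => -2 * k * c k) K :=
  funext fun u => (hasDerivAt_inversePowerSum c K u).deriv

lemma differentiable_inversePowerSum (c : ℕ → ℂ) (K : ℕ) :
    Differentiable ℂ (inversePowerSum c K) :=
  fun u => (hasDerivAt_inversePowerSum c K u).differentiableAt

/-- The recursion for the coefficients is the one imposed by the third-order equation. -/
lemma inversePowerSum_hankelCoeff_succ (K : ℕ) (u : ℂ) :
    inversePowerSum (fun k => -2 * k * hankelCoeff k) (K + 1) u =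
      -(1 / 4) * (Complex.exp (-(2 : ℝ) * u) *
        (inversePowerSum (fun k => -2 * k * (-2 * k * (-2 * k * hankelCoeff k))) K u
          - 3 * inversePowerSum (fun k => -2 * k * (-2 * k * hankelCoeff k)) K u
          + 3 * inversePowerSum (fun k => -2 * k * hankelCoeff k) K u
          - inversePowerSum (fun k => hankelCoeff k) K u)) := by
  simp only [inversePowerSum]
  rw [Finset.sum_range_succ']
  simp only [Finset.mul_sum, ← Finset.sum_sub_distrib, ← Finset.sum_add_distrib, Nat.cast_zero,
    mul_zero, zero_mul, add_zero]
  refine Finset.sum_congr rfl fun k _ => ?_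
  have hk : (k : ℂ) + 1 ≠ 0 := by exact_mod_cast k.succ_ne_zero
  rw [hankelCoeff, pow_succ]
  push_cast
  field_simp
  ring

lemma hankelNormal_expansion_step (K : ℕ)
    (h : ∀ β, 0 ≤ β → β < Real.pi → (fun u => hankelNormal u -
      inversePowerSum (fun k => hankelCoeff k) K u) =O[stripAtTop β] decay (2 * K))
    (hlim : Tendsto (fun s : ℝ => hankelNormal s -
      inversePowerSum (fun k => hankelCoeff k) (K + 1) s) atTop (𝓝 0))
    {β : ℝ} (hβ0 : 0 ≤ β) (hβ : β < Real.pi) :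
    (fun u => hankelNormal u - inversePowerSum (fun k => hankelCoeff k) (K + 1) u)
      =O[stripAtTop β] decay (2 * (K + 1 : ℕ)) := by
  have hd := differentiable_hankelNormal
  have hsub : ∀ {G : ℂ → ℂ} (c : ℕ → ℂ) (K : ℕ), Differentiable ℂ G →
      deriv (fun u => G u - inversePowerSum c K u) =
        fun u => deriv G u - inversePowerSum (fun k => -2 * k * c k) K u := fun {G} c K hG => by
    funext u
    rw [deriv_fun_sub (hG u) (differentiable_inversePowerSum c K u), deriv_inversePowerSum]
  have hR := isBigO_decay_cubic (hd.sub (differentiable_inversePowerSum _ K))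
    (show β < (β + Real.pi) / 2 by linarith) (h _ (by linarith) (by linarith))
  have hR' := (isBigO_decay_mul (cexp_isBigO_decay 2) hR).const_mul_left (-(1 / 4))
  have hderiv : deriv (fun u => hankelNormal u -
      inversePowerSum (fun k => hankelCoeff k) (K + 1) u) =O[stripAtTop β]
        decay (2 * (K + 1 : ℕ)) := by
    rw [show (2 : ℝ) * (K + 1 : ℕ) = 2 + 2 * K by push_cast; ring]
    refine hR'.congr_left fun u => ?_
    change -(1 / 4) * (_ * (deriv (deriv (deriv (fun u => hankelNormal u -
      inversePowerSum (fun k => hankelCoeff k) K u))) u - 3 * deriv (deriv (fun u => hankelNormal u -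
      inversePowerSum (fun k => hankelCoeff k) K u)) u + 3 * deriv (fun u => hankelNormal u -
      inversePowerSum (fun k => hankelCoeff k) K u) u - (hankelNormal u -
      inversePowerSum (fun k => hankelCoeff k) K u))) = _
    rw [hsub _ _ hd, hsub _ _ (differentiable_deriv hd),
      hsub _ _ (differentiable_deriv (differentiable_deriv hd)), hsub _ _ hd]
    beta_reduce
    rw [inversePowerSum_hankelCoeff_succ]
    linear_combination -hankelNormal_ode u
  obtain ⟨c, hc⟩ := exists_const_of_deriv_isBigO_decay
    (hd.sub (differentiable_inversePowerSum _ (K + 1))) (by positivity) hderiv hβ0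
  have hc0 : c = 0 := by
    have h1 := tendsto_zero_of_isBigO_decay hβ0 (by positivity) hc
    have h2 := hlim.sub h1
    simp only [Pi.sub_apply, sub_sub_cancel, sub_zero] at h2
    exact tendsto_nhds_unique tendsto_const_nhds h2
  rw [hc0] at hc
  simpa using hc

/-- The asymptotic expansion of `(π z / 2) H_0^{(1)}(z) H_0^{(2)}(z)` in every sector
`|arg z| ≤ β < π`. -/
lemma hankelNormal_expansion (K : ℕ) : ∀ β, 0 ≤ β → β < Real.pi →
    (fun u => hankelNormal u - inversePowerSum (fun k => hankelCoeff k) K u)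
      =O[stripAtTop β] decay (2 * K) := by
  induction K with
  | zero =>
    intro β h0 h1
    have h := (hankelNormal_leading h0 h1).trans (decay_isBigO_decay (show (0 : ℝ) ≤ 1 / 2 by
      norm_num))
    have h2 : (fun _ : ℂ => (1 : ℂ)) =O[stripAtTop β] decay 0 :=
      Asymptotics.IsBigO.of_bound 1 (Eventually.of_forall fun u => by simp [decay])
    have h3 := h.add h2
    simp only [sub_add_cancel] at h3
    simpa [inversePowerSum] using h3
  | succ K ih =>
    intro β h0 h1
    refine hankelNormal_expansion_step K ih ?_ h0 h1
    rcases K with _ | K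
    · have := tendsto_zero_of_isBigO_decay le_rfl (by norm_num)
        (hankelNormal_leading le_rfl Real.pi_pos)
      simpa [inversePowerSum, hankelCoeff] using this
    · have l1 := tendsto_zero_of_isBigO_decay le_rfl (by positivity) (ih 0 le_rfl Real.pi_pos)
      have lx := tendsto_zero_of_isBigO_decay (β := 0) le_rfl two_pos (cexp_isBigO_decay 2)
      have l2 := l1.sub ((lx.pow (K + 1)).const_mul (hankelCoeff (K + 1) : ℂ))
      simp only [zero_pow K.succ_ne_zero, mul_zero, sub_zero] at l2
      refine l2.congr fun s => ?_
      rw [inversePowerSum, inversePowerSum, Finset.sum_range_succ _ (K + 1)]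
      ring

lemma norm_cexp_neg_two_mul (u : ℂ) (k : ℕ) :
    ‖Complex.exp (-(2 : ℝ) * u) ^ k‖ = decay (2 * k) u := by
  rw [norm_pow, Complex.norm_exp, ← Real.exp_nat_mul, decay]
  congr 1
  simp
  ring

lemma isBigO_aeval_tail (p : Polynomial ℚ) (K : ℕ) {β : ℝ} :
    (fun u => Polynomial.aeval (Complex.exp (-(2 : ℝ) * u)) p -
      ∑ k ∈ Finset.range K, (p.coeff k : ℂ) * Complex.exp (-(2 : ℝ) * u) ^ k)
      =O[stripAtTop β] decay (2 * K) := by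
  have hM : p.natDegree < max K (p.natDegree + 1) := lt_max_of_lt_right (Nat.lt_succ_self _)
  have hO : (∑ k ∈ Finset.Ico K (max K (p.natDegree + 1)), fun u : ℂ =>
      (p.coeff k : ℂ) * Complex.exp (-(2 : ℝ) * u) ^ k) =O[stripAtTop β] decay (2 * K) := by
    refine Asymptotics.IsBigO.sum fun k hk => ?_
    refine Asymptotics.IsBigO.const_mul_left ?_ _
    have h1 : (fun u : ℂ => Complex.exp (-(2 : ℝ) * u) ^ k) =O[stripAtTop β] decay (2 * k) :=
      Asymptotics.IsBigO.of_bound 1 (Eventually.of_forall fun u => by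
        rw [norm_cexp_neg_two_mul, norm_decay, one_mul])
    refine h1.trans (decay_isBigO_decay ?_)
    have : (K : ℝ) ≤ k := by exact_mod_cast (Finset.mem_Ico.1 hk).1
    linarith
  refine hO.congr_left fun u => ?_
  rw [Finset.sum_apply, Finset.sum_Ico_eq_sub _ (le_max_left _ _),
    Polynomial.aeval_eq_sum_range' hM]
  simp only [Algebra.smul_def, eq_ratCast]

lemma isBigO_aeval_one (p : Polynomial ℚ) {β : ℝ} :
    (fun u => Polynomial.aeval (Complex.exp (-(2 : ℝ) * u)) p) =O[stripAtTop β] decay 0 := by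
  simpa using isBigO_aeval_tail p 0 (β := β)

/-- Powers inherit the asymptotic expansion in powers of `z^{-2}`, with rational coefficients. -/
lemma hankelNormal_pow_expansion {β : ℝ} (h0 : 0 ≤ β) (h1 : β < Real.pi) (K m : ℕ) :
    ∃ p : Polynomial ℚ, (fun u => hankelNormal u ^ m -
      Polynomial.aeval (Complex.exp (-(2 : ℝ) * u)) p) =O[stripAtTop β] decay (2 * K) := by
  obtain ⟨q, hq⟩ : ∃ q : Polynomial ℚ, (fun u => hankelNormal u -
      Polynomial.aeval (Complex.exp (-(2 : ℝ) * u)) q) =O[stripAtTop β] decay (2 * K) := by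
    refine ⟨∑ k ∈ Finset.range K, Polynomial.monomial k (hankelCoeff k), ?_⟩
    refine (hankelNormal_expansion K β h0 h1).congr_left fun u => ?_
    simp only [inversePowerSum, map_sum, Polynomial.aeval_monomial, eq_ratCast]
  induction m with
  | zero =>
    refine ⟨1, ?_⟩
    simpa using Asymptotics.isBigO_zero (decay (2 * K)) (stripAtTop β)
  | succ m ih =>
    obtain ⟨p, hp⟩ := ih
    refine ⟨p * q, ?_⟩
    have hF : hankelNormal =O[stripAtTop β] decay 0 := by
      have := (hq.trans (decay_isBigO_decay (show (0 : ℝ) ≤ 2 * K by positivity))).add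
        (isBigO_aeval_one q)
      simpa using this
    have e1 := isBigO_decay_mul hp hF
    have e2 := isBigO_decay_mul (isBigO_aeval_one p) hq
    rw [add_zero] at e1
    rw [zero_add] at e2
    refine (e1.add e2).congr_left fun u => ?_
    rw [map_mul, pow_succ]
    ring

/-! ### The moments as coefficients -/

/-- The function `z^{2j+m} [(π/2)² H_0^{(1)}(z) H_0^{(2)}(z)]^m`, `z = e^u`, whose integral over the
boundary of a rectangle yields the moment. -/
noncomputable def momentKernel (m j : ℕ) (u : ℂ) : ℂ :=
  Complex.exp ((2 * j + m : ℕ) * u) * hankelProd u ^ m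

lemma differentiable_momentKernel (m j : ℕ) : Differentiable ℂ (momentKernel m j) :=
  (Complex.differentiable_exp.comp (differentiable_id.const_mul _)).mul
    (differentiable_hankelProd.pow m)

lemma hankelProd_pow_eq (m : ℕ) (u : ℂ) : hankelProd u ^ m =
    (Real.pi / 2 : ℂ) ^ m * Complex.exp (-(m : ℂ) * u) * hankelNormal u ^ m := by
  have hpi : (Real.pi : ℂ) ≠ 0 := by exact_mod_cast Real.pi_ne_zero
  have h : Complex.exp (-(m : ℂ) * u) = (Complex.exp (-u)) ^ m := by
    rw [← Complex.exp_nat_mul]; ring_nf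
  rw [h, ← mul_pow, ← mul_pow, hankelNormal]
  congr 1
  have : Complex.exp (-u) * Complex.exp u = 1 := by rw [← Complex.exp_add]; simp
  have e : (Real.pi / 2 : ℂ) * (2 / Real.pi) = 1 := by field_simp
  linear_combination -(hankelProd u * (Real.pi / 2 : ℂ) * (2 / Real.pi)) * this
    - hankelProd u * e

lemma momentKernel_eq (m j : ℕ) (u : ℂ) : momentKernel m j u =
    (Real.pi / 2 : ℂ) ^ m * (Complex.exp (2 * j * u) * hankelNormal u ^ m) := by
  rw [momentKernel, hankelProd_pow_eq]
  have : Complex.exp ((2 * j + m : ℕ) * u) * Complex.exp (-(m : ℂ) * u) =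
      Complex.exp (2 * j * u) := by
    rw [← Complex.exp_add]; push_cast; ring_nf
  linear_combination (Real.pi / 2 : ℂ) ^ m * hankelNormal u ^ m * this

lemma norm_momentKernel_le {m : ℕ} (hm : 0 < m) (j : ℕ) : ∃ C : ℝ, 0 ≤ C ∧ ∀ u : ℂ,
    u.re ≤ 0 → |u.im| ≤ Real.pi → ‖momentKernel m j u‖ ≤ C * Real.exp (1 / 2 * u.re) := by
  obtain ⟨M, hM, h⟩ := norm_hankelProd_le_sq
  refine ⟨M ^ m * (2 ^ (2 * m) * (2 * m).factorial * Real.exp (5 / 2)), by positivity,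
    fun u hu hi => ?_⟩
  have h1 : ‖u‖ ≤ -u.re + 4 := by
    have := Complex.norm_le_abs_re_add_abs_im u
    rw [abs_of_nonpos hu] at this
    linarith [Real.pi_le_four]
  have h2 : (1 + ‖u‖) ^ (2 * m) ≤
      2 ^ (2 * m) * (2 * m).factorial * (Real.exp (5 / 2) * Real.exp (-u.re / 2)) := by
    have h3 := Real.pow_div_factorial_le_exp ((5 + -u.re) / 2) (by linarith) (2 * m)
    rw [div_le_iff₀ (by positivity)] at h3
    calc (1 + ‖u‖) ^ (2 * m) ≤ (2 * ((5 + -u.re) / 2)) ^ (2 * m) := by gcongr; linarith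
      _ = 2 ^ (2 * m) * ((5 + -u.re) / 2) ^ (2 * m) := mul_pow _ _ _
      _ ≤ 2 ^ (2 * m) * (Real.exp ((5 + -u.re) / 2) * (2 * m).factorial) := by gcongr
      _ = _ := by rw [← Real.exp_add]; ring_nf
  have h4 : ‖Complex.exp ((2 * j + m : ℕ) * u)‖ ≤ Real.exp u.re := by
    rw [Complex.norm_exp, Real.exp_le_exp]
    have : (1 : ℝ) ≤ (2 * j + m : ℕ) := by exact_mod_cast (by lia : 1 ≤ 2 * j + m)
    have e : (((2 * j + m : ℕ) : ℂ) * u).re = ((2 * j + m : ℕ) : ℝ) * u.re := by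
      rw [← Complex.ofReal_natCast, Complex.re_ofReal_mul]
    rw [e]
    nlinarith
  rw [momentKernel, norm_mul, norm_pow]
  calc _ ≤ Real.exp u.re * (M * (1 + ‖u‖) ^ 2) ^ m := by gcongr; exact h u hi
    _ = M ^ m * ((1 + ‖u‖) ^ (2 * m) * Real.exp u.re) := by rw [mul_pow, ← pow_mul]; ring
    _ ≤ M ^ m * (2 ^ (2 * m) * (2 * m).factorial *
        (Real.exp (5 / 2) * Real.exp (-u.re / 2)) * Real.exp u.re) := by gcongr
    _ = M ^ m * (2 ^ (2 * m) * (2 * m).factorial * Real.exp (5 / 2)) *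
        (Real.exp (-u.re / 2) * Real.exp u.re) := by ring
    _ = _ := by rw [← Real.exp_add]; ring_nf

/-- The difference of the kernel across the imaginary axis in the `z`-plane, parametrized by
`z = ± i e^x`. -/
noncomputable def momentJump (m j : ℕ) (x : ℝ) : ℂ :=
  momentKernel m j (x + Real.pi / 2 * Complex.I) - momentKernel m j (x - Real.pi / 2 * Complex.I)

lemma hankelProd_sub_half_pi (u : ℂ) : hankelProd (u - Real.pi / 2 * Complex.I) =
    expK u * (expK u + Real.pi * Complex.I * expI u) := by
  have h := expK_add_pi (u - Real.pi * Complex.I)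
  have h2 := expI_add_pi (u - Real.pi * Complex.I)
  rw [sub_add_cancel] at h h2
  rw [hankelProd, sub_add_cancel, show u - Real.pi / 2 * Complex.I - Real.pi / 2 * Complex.I
    = u - Real.pi * Complex.I by ring, h2, h]
  ring

lemma momentJump_eq (m j : ℕ) (x : ℝ) : momentJump m j x =
    (-1) ^ j * ((Real.exp x : ℂ) ^ (2 * j + m) * ((realK x : ℂ) ^ m *
      ((Real.pi * realI x + Complex.I * realK x) ^ m
        - (Real.pi * realI x - Complex.I * realK x) ^ m))) := by
  have hI : ∀ n : ℕ, Complex.exp (n * (Real.pi / 2 * Complex.I)) = Complex.I ^ n := fun n => by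
    rw [Complex.exp_nat_mul, Complex.exp_pi_div_two_mul_I]
  have hI' : ∀ n : ℕ, Complex.exp (-(n * (Real.pi / 2 * Complex.I))) = (-Complex.I) ^ n :=
    fun n => by rw [Complex.exp_neg, hI, ← inv_pow, Complex.inv_I]
  have hx : Complex.exp ((2 * j + m : ℕ) * (x : ℂ)) = (Real.exp x : ℂ) ^ (2 * j + m) := by
    rw [Complex.exp_nat_mul, Complex.ofReal_exp]
  have hup : Complex.exp ((2 * j + m : ℕ) * ((x : ℂ) + Real.pi / 2 * Complex.I)) =
      (Real.exp x : ℂ) ^ (2 * j + m) * Complex.I ^ (2 * j + m) := by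
    rw [mul_add, Complex.exp_add, hI, hx]
  have hdown : Complex.exp ((2 * j + m : ℕ) * ((x : ℂ) - Real.pi / 2 * Complex.I)) =
      (Real.exp x : ℂ) ^ (2 * j + m) * (-Complex.I) ^ (2 * j + m) := by
    rw [mul_sub, sub_eq_add_neg, Complex.exp_add, hI', hx]
  rw [momentJump, momentKernel, momentKernel, hankelProd_add_half_pi, hankelProd_sub_half_pi,
    hup, hdown, expK_ofReal, expI_ofReal]
  have e1 : Complex.I ^ (2 * j + m) *
      ((realK x : ℂ) * (realK x - Real.pi * Complex.I * realI x)) ^ m =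
      (-1) ^ j * ((realK x : ℂ) ^ m * (Real.pi * realI x + Complex.I * realK x) ^ m) := by
    rw [pow_add, pow_mul, Complex.I_sq, mul_assoc, ← mul_pow, ← mul_pow]
    congr 2
    linear_combination -((realK x : ℂ) * Real.pi * realI x) * Complex.I_sq
  have e2 : (-Complex.I) ^ (2 * j + m) *
      ((realK x : ℂ) * (realK x + Real.pi * Complex.I * realI x)) ^ m =
      (-1) ^ j * ((realK x : ℂ) ^ m * (Real.pi * realI x - Complex.I * realK x) ^ m) := by
    rw [pow_add, pow_mul, neg_sq, Complex.I_sq, mul_assoc, ← mul_pow, ← mul_pow]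
    congr 2
    linear_combination -((realK x : ℂ) * Real.pi * realI x) * Complex.I_sq
  linear_combination (Real.exp x : ℂ) ^ (2 * j + m) * (e1 - e2)

/-- The leading terms of the two powers cancel, which leaves a factor `K_0²`. -/
lemma norm_pow_mul_sub_pow_le {k a b : ℂ} {B : ℝ} (ha : ‖k * a‖ ≤ B) (hb : ‖k * b‖ ≤ B) (m : ℕ) :
    ‖k ^ (m + 1) * (a ^ (m + 1) - b ^ (m + 1))‖ ≤ (m + 1) * ‖k * (a - b)‖ * B ^ m := by
  induction m with
  | zero => simp
  | succ m ih =>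
    have e : k ^ (m + 1 + 1) * (a ^ (m + 1 + 1) - b ^ (m + 1 + 1)) =
        k * a * (k ^ (m + 1) * (a ^ (m + 1) - b ^ (m + 1))) + k * (a - b) * (k * b) ^ (m + 1) := by
      ring
    rw [e]
    refine (norm_add_le _ _).trans ?_
    rw [norm_mul (k * a), norm_mul (k * (a - b)), norm_pow]
    have hB : 0 ≤ B := (norm_nonneg _).trans ha
    calc _ ≤ B * ((m + 1) * ‖k * (a - b)‖ * B ^ m) + ‖k * (a - b)‖ * B ^ (m + 1) := by gcongr
      _ = _ := by push_cast; ring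

lemma norm_momentJump_le_of_nonneg {m : ℕ} (hm : 0 < m) (j : ℕ) : ∃ C : ℝ, ∀ x : ℝ, 0 ≤ x →
    ‖momentJump m j x‖ ≤ C * Real.exp (-1 * x) := by
  obtain ⟨m, rfl⟩ := Nat.exists_eq_add_of_lt hm
  rw [zero_add]
  set e := 2 * j + (m + 1) with he
  set B : ℝ := 4 * (5 / 2) + (5 / 2) ^ 2 with hB
  refine ⟨(m + 1) * (2 * (5 / 2 * (5 / 2 / coeffI e))) * B ^ m, fun x hx => ?_⟩
  have hK0 := realK_nonneg x
  have hI1 := one_le_realI x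
  have hKI := realK_mul_realI_le hx
  have hK2 := realK_le_of_nonneg hx
  have hab : ∀ s : ℂ, ‖s‖ = 1 →
      ‖(realK x : ℂ) * (Real.pi * realI x + s * realK x)‖ ≤ B := fun s hs => by
    rw [norm_mul, Complex.norm_real, Real.norm_of_nonneg hK0]
    have : ‖(Real.pi : ℂ) * realI x + s * realK x‖ ≤ 4 * realI x + realK x := by
      refine (norm_add_le _ _).trans ?_
      rw [norm_mul, norm_mul, hs, one_mul, Complex.norm_real, Complex.norm_real,
        Complex.norm_real, Real.norm_of_nonneg Real.pi_pos.le, Real.norm_of_nonneg hK0,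
        Real.norm_of_nonneg (by linarith)]
      gcongr
      exact Real.pi_le_four
    calc _ ≤ realK x * (4 * realI x + realK x) := by gcongr
      _ = 4 * (realK x * realI x) + realK x ^ 2 := by ring
      _ ≤ B := by rw [hB]; gcongr
  have h1 := norm_pow_mul_sub_pow_le (hab Complex.I Complex.norm_I)
    (hab (-Complex.I) (by rw [norm_neg, Complex.norm_I])) m
  have h2 : ‖(realK x : ℂ) * (Real.pi * realI x + Complex.I * realK x -
      (Real.pi * realI x + -Complex.I * realK x))‖ = 2 * realK x ^ 2 := by
    have : (realK x : ℂ) * (Real.pi * realI x + Complex.I * realK x -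
      (Real.pi * realI x + -Complex.I * realK x)) =
        ((2 * realK x ^ 2 : ℝ) : ℂ) * Complex.I := by push_cast; ring
    rw [this, norm_mul, Complex.norm_I, mul_one, Complex.norm_real,
      Real.norm_of_nonneg (by positivity)]
  rw [h2] at h1
  -- `K_0` decays faster than any power, because `K_0 I_0` is bounded.
  have hc := coeffI_pos e
  have hex := Real.exp_pos x
  have h3 : realK x * Real.exp x ^ (2 * e) ≤ 5 / 2 / coeffI e := by
    rw [le_div_iff₀ hc]
    have := mul_le_mul_of_nonneg_left (coeffI_mul_exp_le_realI e x) hK0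
    linarith
  have h4 : realK x ^ 2 * Real.exp x ^ e ≤ 5 / 2 * (5 / 2 / coeffI e) * Real.exp (-1 * x) := by
    have h5 : realK x ^ 2 * Real.exp x ^ (2 * e) ≤ 5 / 2 * (5 / 2 / coeffI e) := by
      calc realK x ^ 2 * Real.exp x ^ (2 * e) = realK x * (realK x * Real.exp x ^ (2 * e)) := by
            ring
        _ ≤ _ := by gcongr
    have h6 : Real.exp x ^ e = Real.exp x ^ (2 * e) * Real.exp (-1 * (e * x)) := by
      rw [← Real.exp_nat_mul, ← Real.exp_nat_mul, ← Real.exp_add]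
      push_cast; ring_nf
    have h7 : Real.exp (-1 * (e * x)) ≤ Real.exp (-1 * x) := by
      have : (1 : ℝ) ≤ e := by exact_mod_cast (by lia : 1 ≤ e)
      rw [Real.exp_le_exp]
      nlinarith
    rw [h6, ← mul_assoc]
    gcongr
  rw [momentJump_eq, norm_mul, norm_mul, norm_pow, norm_neg, norm_one, one_pow, one_mul, norm_pow,
    Complex.norm_real, Real.norm_of_nonneg hex.le, ← he]
  have h8 : ‖(realK x : ℂ) ^ (m + 1) * ((Real.pi * realI x + Complex.I * realK x) ^ (m + 1)
      - (Real.pi * realI x - Complex.I * realK x) ^ (m + 1))‖ ≤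
      (m + 1) * (2 * realK x ^ 2) * B ^ m := by
    rw [sub_eq_add_neg (Real.pi * realI x : ℂ), ← neg_mul]
    exact h1
  calc _ ≤ Real.exp x ^ e * ((m + 1) * (2 * realK x ^ 2) * B ^ m) := by gcongr
    _ = (m + 1) * 2 * B ^ m * (realK x ^ 2 * Real.exp x ^ e) := by ring
    _ ≤ (m + 1) * 2 * B ^ m * (5 / 2 * (5 / 2 / coeffI e) * Real.exp (-1 * x)) := by gcongr
    _ = _ := by ring

lemma continuous_momentJump (m j : ℕ) : Continuous (momentJump m j) := by
  have h := (differentiable_momentKernel m j).continuous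
  unfold momentJump
  fun_prop

lemma integrable_momentJump {m : ℕ} (hm : 0 < m) (j : ℕ) :
    MeasureTheory.Integrable (momentJump m j) := by
  have hmeas := (continuous_momentJump m j).aestronglyMeasurable
    (μ := MeasureTheory.volume)
  obtain ⟨C, hC⟩ := norm_momentJump_le_of_nonneg hm j
  obtain ⟨C', hC'0, hC'⟩ := norm_momentKernel_le hm j
  rw [← MeasureTheory.integrableOn_univ, ← Set.Iic_union_Ioi (a := (0 : ℝ))]
  refine MeasureTheory.IntegrableOn.union ?_ ?_
  · refine MeasureTheory.Integrable.mono'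
      ((integrableOn_exp_mul_Iic (a := 1 / 2) (by norm_num) 0).const_mul (2 * C')) hmeas.restrict
      ((MeasureTheory.ae_restrict_iff' measurableSet_Iic).2 (Eventually.of_forall fun x hx => ?_))
    have hb : |Real.pi / 2| ≤ Real.pi := by
      rw [abs_of_pos (by positivity)]; linarith [Real.pi_pos]
    have h1 := hC' (x + Real.pi / 2 * Complex.I) (by simpa using hx) (by simpa using hb)
    have h2 := hC' (x - Real.pi / 2 * Complex.I) (by simpa using hx) (by simpa using hb)
    have e1 : ((x : ℂ) + Real.pi / 2 * Complex.I).re = x := by simp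
    have e2 : ((x : ℂ) - Real.pi / 2 * Complex.I).re = x := by simp
    rw [e1] at h1
    rw [e2] at h2
    refine (norm_sub_le _ _).trans ?_
    linarith
  · exact MeasureTheory.Integrable.mono'
      ((integrableOn_exp_mul_Ioi (a := -1) (by norm_num) 0).const_mul C) hmeas.restrict
      ((MeasureTheory.ae_restrict_iff' measurableSet_Ioi).2
        (Eventually.of_forall fun x hx => hC x (le_of_lt hx)))

lemma integral_exp_even (d : ℤ) (L : ℝ) :
    ∫ y in (-(Real.pi / 2))..(Real.pi / 2), Complex.exp (2 * d * (L + y * Complex.I)) =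
      if d = 0 then (Real.pi : ℂ) else 0 := by
  split_ifs with hd
  · simp [hd]
  · have hc : (2 : ℂ) * d * Complex.I ≠ 0 :=
      mul_ne_zero (mul_ne_zero two_ne_zero (Int.cast_ne_zero.2 hd)) Complex.I_ne_zero
    have e : ∀ y : ℝ, Complex.exp (2 * d * (L + y * Complex.I)) =
        Complex.exp (2 * d * L) * Complex.exp (2 * d * Complex.I * y) := fun y => by
      rw [← Complex.exp_add]; ring_nf
    simp_rw [e]
    rw [intervalIntegral.integral_const_mul, integral_exp_mul_complex hc]
    have h := Complex.exp_periodic.int_mul d (2 * d * Complex.I * ((-(Real.pi / 2) : ℝ) : ℂ))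
    have e2 : (2 : ℂ) * d * Complex.I * ((-(Real.pi / 2) : ℝ) : ℂ) + d * (2 * Real.pi * Complex.I)
        = 2 * d * Complex.I * ((Real.pi / 2 : ℝ) : ℂ) := by push_cast; ring
    rw [e2] at h
    rw [h, sub_self, zero_div, mul_zero]

lemma integral_exp_mul_aeval (p : Polynomial ℚ) (j : ℕ) (L : ℝ) :
    ∫ y in (-(Real.pi / 2))..(Real.pi / 2), Complex.exp (2 * j * (L + y * Complex.I)) *
      Polynomial.aeval (Complex.exp (-(2 : ℝ) * (L + y * Complex.I))) p =
      Real.pi * p.coeff j := by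
  have hM : p.natDegree < max (j + 1) (p.natDegree + 1) := lt_max_of_lt_right (Nat.lt_succ_self _)
  have e : ∀ y : ℝ, Complex.exp (2 * j * (L + y * Complex.I)) *
      Polynomial.aeval (Complex.exp (-(2 : ℝ) * (L + y * Complex.I))) p =
      ∑ k ∈ Finset.range (max (j + 1) (p.natDegree + 1)), (p.coeff k : ℂ) *
        Complex.exp (2 * ((j : ℤ) - (k : ℤ) : ℤ) * (L + y * Complex.I)) := fun y => by
    rw [Polynomial.aeval_eq_sum_range' hM, Finset.mul_sum]
    refine Finset.sum_congr rfl fun k _ => ?_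
    rw [Algebra.smul_def, eq_ratCast, mul_left_comm, ← Complex.exp_nat_mul, ← Complex.exp_add]
    push_cast
    ring_nf
  simp_rw [e]
  rw [intervalIntegral.integral_finsetSum fun k _ => by
    apply Continuous.intervalIntegrable; fun_prop]
  simp_rw [intervalIntegral.integral_const_mul, integral_exp_even]
  rw [Finset.sum_eq_single_of_mem j (Finset.mem_range.2 (lt_max_of_lt_left (Nat.lt_succ_self _)))]
  · simp [mul_comm]
  · intro k _ hk
    rw [if_neg (by lia), mul_zero]

lemma momentKernel_expansion {m j K : ℕ} (hK : j < K) {p : Polynomial ℚ} {β : ℝ}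
    (hp : (fun u => hankelNormal u ^ m - Polynomial.aeval (Complex.exp (-(2 : ℝ) * u)) p)
      =O[stripAtTop β] decay (2 * K)) :
    (fun u => momentKernel m j u - (Real.pi / 2 : ℂ) ^ m * (Complex.exp (2 * j * u) *
      Polynomial.aeval (Complex.exp (-(2 : ℝ) * u)) p)) =O[stripAtTop β] decay 2 := by
  have h1 : (fun u : ℂ => Complex.exp (2 * j * u)) =O[stripAtTop β] decay (-(2 * j)) := by
    have := cexp_isBigO_decay (β := β) (-(2 * j))
    refine this.congr_left fun u => ?_
    push_cast; ring_nf
  have h2 := ((isBigO_decay_mul h1 hp).const_mul_left ((Real.pi / 2 : ℂ) ^ m)).trans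
    (decay_isBigO_decay (b := 2) ?_)
  · refine h2.congr_left fun u => ?_
    rw [momentKernel_eq]; ring
  · have : (j : ℝ) + 1 ≤ K := by exact_mod_cast hK
    linarith

/-- The integral over the right edge of the rectangle, a large half-circle in the `z`-plane, picks
out a single coefficient of the expansion. -/
lemma tendsto_right_edge {m j K : ℕ} (hK : j < K) {p : Polynomial ℚ}
    (hp : (fun u => hankelNormal u ^ m - Polynomial.aeval (Complex.exp (-(2 : ℝ) * u)) p)
      =O[stripAtTop (Real.pi / 2)] decay (2 * K)) :
    Tendsto (fun L : ℝ => ∫ y in (-(Real.pi / 2))..(Real.pi / 2),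
      momentKernel m j (L + y * Complex.I)) atTop
      (𝓝 ((Real.pi / 2 : ℂ) ^ m * (Real.pi * p.coeff j))) := by
  obtain ⟨C, r, hC, h⟩ := isBigO_decay_iff.1 (momentKernel_expansion hK hp)
  have hπ := Real.pi_pos
  rw [tendsto_iff_norm_sub_tendsto_zero]
  have hlim : Tendsto (fun L : ℝ => C * Real.exp (-2 * L) * |Real.pi / 2 - -(Real.pi / 2)|)
      atTop (𝓝 0) := by
    have := ((Real.tendsto_exp_atBot.comp (tendsto_id.const_mul_atTop_of_neg
      (show (-2 : ℝ) < 0 by norm_num))).const_mul C).mul_const |Real.pi / 2 - -(Real.pi / 2)|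
    simpa using this
  refine squeeze_zero' (Eventually.of_forall fun _ => norm_nonneg _) ?_ hlim
  filter_upwards [eventually_ge_atTop r] with L hL
  have hcont := (differentiable_momentKernel m j).continuous
  rw [← integral_exp_mul_aeval p j L, ← intervalIntegral.integral_const_mul,
    ← intervalIntegral.integral_sub]
  · refine intervalIntegral.norm_integral_le_of_norm_le_const fun y hy => ?_
    rw [Set.uIoc_of_le (by linarith)] at hy
    have := h (L + y * Complex.I) (by simpa using hL)
      (abs_le.2 ⟨by simpa using hy.1.le, by simpa using hy.2⟩)
    simpa [decay] using this
  · apply Continuous.intervalIntegrable; fun_prop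
  · apply Continuous.intervalIntegrable; fun_prop

lemma tendsto_left_edge {m : ℕ} (hm : 0 < m) (j : ℕ) :
    Tendsto (fun L : ℝ => ∫ y in (-(Real.pi / 2))..(Real.pi / 2),
      momentKernel m j ((-L : ℝ) + y * Complex.I)) atTop (𝓝 0) := by
  obtain ⟨C, hC, h⟩ := norm_momentKernel_le hm j
  have hπ := Real.pi_pos
  have hlim : Tendsto (fun L : ℝ => C * Real.exp (-(1 / 2) * L) * |Real.pi / 2 - -(Real.pi / 2)|)
      atTop (𝓝 0) := by
    have := ((Real.tendsto_exp_atBot.comp (tendsto_id.const_mul_atTop_of_neg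
      (show (-(1 / 2) : ℝ) < 0 by norm_num))).const_mul C).mul_const |Real.pi / 2 - -(Real.pi / 2)|
    simpa using this
  refine squeeze_zero_norm' ?_ hlim
  filter_upwards [eventually_ge_atTop 0] with L hL
  refine intervalIntegral.norm_integral_le_of_norm_le_const fun y hy => ?_
  rw [Set.uIoc_of_le (by linarith)] at hy
  have := h ((-L : ℝ) + y * Complex.I) (by simpa using hL) (by
    have : |y| ≤ Real.pi := abs_le.2 ⟨by linarith [hy.1], by linarith [hy.2]⟩
    simpa using this)
  refine this.trans (le_of_eq ?_)
  congr 2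
  simp

/-- Cauchy's theorem on the rectangle `[-L, L] × [-π/2, π/2]` in the variable `u = log z`. -/
lemma integral_momentJump {m j K : ℕ} (hm : 0 < m) (hK : j < K) {p : Polynomial ℚ}
    (hp : (fun u => hankelNormal u ^ m - Polynomial.aeval (Complex.exp (-(2 : ℝ) * u)) p)
      =O[stripAtTop (Real.pi / 2)] decay (2 * K)) :
    ∫ x, momentJump m j x = Complex.I * ((Real.pi / 2 : ℂ) ^ m * (Real.pi * p.coeff j)) := by
  have hcont := (differentiable_momentKernel m j).continuous
  have hrect : ∀ L : ℝ, ∫ x in (-L)..L, momentJump m j x =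
      Complex.I * (∫ y in (-(Real.pi / 2))..(Real.pi / 2), momentKernel m j (L + y * Complex.I)) -
      Complex.I * ∫ y in (-(Real.pi / 2))..(Real.pi / 2),
        momentKernel m j ((-L : ℝ) + y * Complex.I) := fun L => by
    have h := Complex.integral_boundary_rect_eq_zero_of_differentiableOn (momentKernel m j)
      ⟨-L, -(Real.pi / 2)⟩ ⟨L, Real.pi / 2⟩ (differentiable_momentKernel m j).differentiableOn
    simp only [smul_eq_mul] at h
    unfold momentJump
    rw [intervalIntegral.integral_sub]
    · have e : ∀ x : ℝ, (x : ℂ) - Real.pi / 2 * Complex.I =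
          x + ((-(Real.pi / 2) : ℝ) : ℂ) * Complex.I := fun x => by push_cast; ring
      have e' : ∀ x : ℝ, (x : ℂ) + Real.pi / 2 * Complex.I =
          x + ((Real.pi / 2 : ℝ) : ℂ) * Complex.I := fun x => by push_cast; ring
      simp_rw [e, e']
      linear_combination -h
    · apply Continuous.intervalIntegrable; fun_prop
    · apply Continuous.intervalIntegrable; fun_prop
  have h1 := MeasureTheory.intervalIntegral_tendsto_integral (integrable_momentJump hm j)
    tendsto_neg_atTop_atBot tendsto_id
  have h2 := ((tendsto_right_edge hK hp).const_mul Complex.I).sub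
    ((tendsto_left_edge hm j).const_mul Complex.I)
  simp only [id] at h1
  simp_rw [hrect] at h1
  rw [mul_zero, sub_zero] at h2
  exact tendsto_nhds_unique h1 h2

/-! ### Moments, expansion and rationality -/

lemma momentIntegrand_exp {m : ℕ} (hm : 0 < m) (j : ℕ) (x : ℝ) :
    |Real.exp x| • momentIntegrand m (j + 1) (Real.exp x) =
      (-1) ^ j / (Real.pi * Complex.I) * momentJump m j x := by
  have hz : (Real.exp x : ℂ) ≠ 0 := by exact_mod_cast (Real.exp_pos x).ne'
  have hlog : Complex.log (Real.exp x : ℂ) = x := by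
    rw [← Complex.ofReal_log (Real.exp_pos x).le, Real.log_exp]
  have hexp : 2 * j + m = 2 * (j + 1) + m - 3 + 1 := by lia
  have hsq : ((-1 : ℂ) ^ j) * (-1) ^ j = 1 := by rw [← mul_pow]; norm_num
  rw [abs_of_pos (Real.exp_pos x), Complex.real_smul, momentIntegrand, besselDiff,
    besselI_zero_eq hz, besselK_zero_eq hz, hlog, expI_ofReal, expK_ofReal, momentJump_eq, hexp,
    pow_succ]
  set D : ℂ := (Real.pi * realI x + Complex.I * realK x) ^ m -
    (Real.pi * realI x - Complex.I * realK x) ^ m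
  linear_combination -(Real.exp x : ℂ) * D / (Real.pi * Complex.I) * (realK x : ℂ) ^ m *
    (Real.exp x : ℂ) ^ (2 * (j + 1) + m - 3) * hsq

lemma integrableOn_momentIntegrand {m : ℕ} (hm : 0 < m) (j : ℕ) :
    MeasureTheory.IntegrableOn (momentIntegrand m (j + 1)) (Set.Ioi (0 : ℝ)) := by
  rw [← Real.range_exp, ← Set.image_univ,
    MeasureTheory.integrableOn_image_iff_integrableOn_abs_deriv_smul MeasurableSet.univ
      (fun x _ => (Real.hasDerivAt_exp x).hasDerivWithinAt) Real.exp_injective.injOn]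
  simp_rw [momentIntegrand_exp hm]
  rw [MeasureTheory.integrableOn_univ]
  exact (integrable_momentJump hm j).const_mul _

lemma integral_momentIntegrand {m j K : ℕ} (hm : 0 < m) (hK : j < K) {p : Polynomial ℚ}
    (hp : (fun u => hankelNormal u ^ m - Polynomial.aeval (Complex.exp (-(2 : ℝ) * u)) p)
      =O[stripAtTop (Real.pi / 2)] decay (2 * K)) :
    ∫ t in Set.Ioi (0 : ℝ), momentIntegrand m (j + 1) t =
      (-1) ^ j * ((Real.pi / 2 : ℂ) ^ m * p.coeff j) := by
  have hpi : (Real.pi : ℂ) ≠ 0 := by exact_mod_cast Real.pi_ne_zero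
  rw [← Real.range_exp, ← Set.image_univ,
    MeasureTheory.integral_image_eq_integral_abs_deriv_smul MeasurableSet.univ
      (fun x _ => (Real.hasDerivAt_exp x).hasDerivWithinAt) Real.exp_injective.injOn]
  simp_rw [momentIntegrand_exp hm]
  rw [MeasureTheory.Measure.restrict_univ, MeasureTheory.integral_const_mul,
    integral_momentJump hm hK hp]
  field_simp [Complex.I_ne_zero]

lemma tendsto_log_stripAtTop (β : ℝ) :
    Tendsto Complex.log (Bornology.cobounded ℂ ⊓ 𝓟 {z : ℂ | |z.arg| ≤ β}) (stripAtTop β) := by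
  rw [stripAtTop, tendsto_inf]
  constructor
  · rw [tendsto_comap_iff]
    have : Complex.re ∘ Complex.log = fun z => Real.log ‖z‖ := funext fun z => Complex.log_re z
    rw [this]
    exact (Real.tendsto_log_atTop.comp tendsto_norm_cobounded_atTop).mono_left inf_le_left
  · rw [tendsto_principal]
    filter_upwards [mem_inf_of_right (mem_principal_self _)] with z hz
    simpa [Complex.log_im] using hz

lemma hankelProd_pow_expansion {m N : ℕ} {β : ℝ} {p : Polynomial ℚ}
    (hp : (fun u => hankelNormal u ^ m - Polynomial.aeval (Complex.exp (-(2 : ℝ) * u)) p)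
      =O[stripAtTop β] decay (2 * N)) :
    (fun u => hankelProd u ^ m - ∑ j ∈ Finset.range N,
      (Real.pi / 2 : ℂ) ^ m * p.coeff j * Complex.exp (-((2 * j + m : ℕ) : ℂ) * u))
      =O[stripAtTop β] decay (2 * N + m) := by
  have h1 := (isBigO_decay_mul (hp.add (isBigO_aeval_tail p N))
    (cexp_isBigO_decay (m : ℝ))).const_mul_left ((Real.pi / 2 : ℂ) ^ m)
  refine h1.congr_left fun u => ?_
  rw [hankelProd_pow_eq, sub_add_sub_cancel, sub_mul, mul_sub, Finset.sum_mul, Finset.mul_sum]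
  congr 1
  · push_cast; ring
  · refine Finset.sum_congr rfl fun j _ => ?_
    rw [mul_assoc (p.coeff j : ℂ), ← Complex.exp_nat_mul, ← Complex.exp_add, mul_assoc]
    push_cast
    ring_nf

lemma exp_neg_natCast_mul_log {z : ℂ} (hz : z ≠ 0) (k : ℕ) :
    Complex.exp (-(k : ℂ) * Complex.log z) = 1 / z ^ k := by
  rw [neg_mul, Complex.exp_neg, Complex.exp_nat_mul, Complex.exp_log hz, one_div]

lemma decay_log {z : ℂ} (hz : z ≠ 0) (k : ℕ) : decay k (Complex.log z) = 1 / ‖z‖ ^ k := by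
  rw [decay, Complex.log_re, neg_mul, Real.exp_neg, Real.exp_nat_mul,
    Real.exp_log (norm_pos_iff.2 hz), one_div]

lemma sum_Icc_one (f : ℕ → ℂ) (N : ℕ) :
    ∑ n ∈ Finset.Icc 1 N, f n = ∑ j ∈ Finset.range N, f (j + 1) := by
  rw [Finset.range_eq_Ico, Finset.sum_Ico_add' f 0 N 1]
  refine Finset.sum_congr ?_ fun _ _ => rfl
  ext n
  simp only [Finset.mem_Icc, Finset.mem_Ico]
  lia

theorem mainTheorem7 (m : ℕ) (hm : 0 < m) :
    (∀ n : ℕ, 0 < n →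
      MeasureTheory.IntegrableOn (momentIntegrand m n) (Set.Ioi (0 : ℝ))) ∧
    (∀ N : ℕ, 0 < N → ∀ δ : ℝ, 0 < δ →
      (fun z : ℂ =>
          ((Real.pi : ℂ) / 2) ^ (2 * m) * (hankelOne z * hankelTwo z) ^ m
            - ∑ n ∈ Finset.Icc 1 N, (-1) ^ (n + 1) / z ^ (2 * n + m - 2)
                * ∫ t in Set.Ioi (0 : ℝ), momentIntegrand m n t)
        =O[Bornology.cobounded ℂ ⊓ Filter.principal {z : ℂ | |z.arg| ≤ Real.pi - δ}]
          (fun z : ℂ => 1 / ‖z‖ ^ (2 * N + m))) ∧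
    (∀ n : ℕ, 0 < n → ∃ q : ℚ, crandallC m n = (q : ℂ)) := by
  have hπ := Real.pi_pos
  refine ⟨fun n hn => ?_, fun N hN δ hδ => ?_, fun n hn => ?_⟩
  · obtain ⟨j, rfl⟩ := Nat.exists_eq_add_of_lt hn
    rw [zero_add]
    exact integrableOn_momentIntegrand hm j
  · -- The sector has to contain the right half-plane, where the moments are computed.
    set β := Real.pi - min δ (Real.pi / 2) with hβ
    have hmin : min δ (Real.pi / 2) ≤ Real.pi / 2 := min_le_right _ _
    have hmin0 : 0 < min δ (Real.pi / 2) := lt_min hδ (by positivity)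
    obtain ⟨p, hp⟩ := hankelNormal_pow_expansion (β := β) (by linarith) (by linarith) N m
    have hp' := hp.mono (stripAtTop_mono (show Real.pi / 2 ≤ β by linarith))
    have hsec : Bornology.cobounded ℂ ⊓ 𝓟 {z : ℂ | |z.arg| ≤ Real.pi - δ} ≤
        Bornology.cobounded ℂ ⊓ 𝓟 {z : ℂ | |z.arg| ≤ β} :=
      inf_le_inf_left _ (principal_mono.2 fun z (hz : |z.arg| ≤ Real.pi - δ) =>
        show |z.arg| ≤ β by linarith [min_le_left δ (Real.pi / 2)])
    have hne : ∀ᶠ z : ℂ in Bornology.cobounded ℂ ⊓ 𝓟 {z : ℂ | |z.arg| ≤ β}, z ≠ 0 := by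
      have := (tendsto_norm_cobounded_atTop (E := ℂ)).eventually (eventually_gt_atTop 0)
      filter_upwards [this.filter_mono inf_le_left] with z hz
      exact norm_pos_iff.1 hz
    refine Asymptotics.IsBigO.mono ?_ hsec
    refine ((hankelProd_pow_expansion hp).comp_tendsto (tendsto_log_stripAtTop β)).congr' ?_ ?_
    · filter_upwards [hne] with z hz
      simp only [Function.comp_apply]
      rw [← hankel_mul_eq hz, mul_pow, ← pow_mul, sum_Icc_one]
      congr 1
      refine Finset.sum_congr rfl fun j hj => ?_
      rw [integral_momentIntegrand hm (Finset.mem_range.1 hj) hp', exp_neg_natCast_mul_log hz,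
        show 2 * (j + 1) + m - 2 = 2 * j + m by lia]
      have hsq : ((-1 : ℂ) ^ j) * (-1) ^ j = 1 := by rw [← mul_pow]; norm_num
      rw [add_assoc, pow_add]
      linear_combination -((Real.pi / 2 : ℂ) ^ m * p.coeff j * (1 / z ^ (2 * j + m))) * hsq
    · filter_upwards [hne] with z hz
      simp only [Function.comp_apply]
      rw [← decay_log hz]
      push_cast; rfl
  · obtain ⟨j, rfl⟩ := Nat.exists_eq_add_of_lt hn
    rw [zero_add]
    obtain ⟨p, hp⟩ := hankelNormal_pow_expansion (β := Real.pi / 2) (by positivity)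
      (by linarith) (j + 1) m
    have hpi : (Real.pi : ℂ) ≠ 0 := by exact_mod_cast Real.pi_ne_zero
    have hint : ∀ t : ℝ, besselDiff m t / Complex.I * besselK 0 t ^ m *
        (2 * (t : ℂ)) ^ (2 * (j + 1) + m - 3) =
        (Real.pi * 2 ^ (2 * (j + 1) + m - 3)) * momentIntegrand m (j + 1) t := fun t => by
      rw [momentIntegrand, mul_pow]
      field_simp
    refine ⟨(2 : ℚ) ^ (1 + 2 * (((j + 1 : ℕ) : ℤ) - 1) * (1 - (-1) ^ m)) *
      2 ^ (2 * (j + 1) + m - 3) * ((-1) ^ j * (1 / 2 ^ m * p.coeff j)), ?_⟩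
    rw [crandallC]
    simp_rw [hint]
    rw [MeasureTheory.integral_const_mul, integral_momentIntegrand hm (Nat.lt_succ_self j) hp]
    push_cast
    rw [div_pow, pow_succ]
    field_simp
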